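/- All graphs are finite, undirected, unweighted and without self-loops; $A$ denotes the adjacency matrix. A path of length $L$ from $i$ to $j$ is a walk with $L$ edges whose $L+1$ nodes are pairwise different. An MLP is a multi-layer perceptron with ReLU activation. **Architecture.** Write $A=U\,\mathrm{diag}(\Lambda)\,U^{T}$, where $\Lambda\in\mathbb{R}^r$ lists the non-zero eigenvalues of $A$ with multiplicity and the columns of $U\in\mathbb{R}^{n\times r}$ are corresponding orthonormal eigenvectors. A Point Set Transformer (PST) with hidden dimension $d$ and $H\ge 1$ heads keeps for each node $i$ a scalar representation $s_i\in\mathbb{R}^d$, initialized with the node feature $X_i\in\mathbb{R}^m$ ($m\le d$, padded with zeros), and a vector representation $v_i\in\mathbb{R}^{r\times d}$, whose channel $c$ is initialized with the $i$-th row of $U\,\mathrm{diag}(f_c(\Lambda))$, where $f=(f_1,\dots,f_d)$ is a continuous permutation-equivariant function $\mathbb{R}^r\to\mathbb{R}^{r\times d}$, given for every $r$. Each layer has its own matrices $W$ and MLPs and consists of 1. a scalar-vector mixer $s_i'=\mathrm{MLP}_1\big(s_i\Vert \mathrm{diagonal}(W_1v_i^Tv_iW_2)\big)$, $\;v_i'=v_i\,\mathrm{diag}(\mathrm{MLP}_2(g_i))W_3+v_iW_4$;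 2. attention matrices $\mathrm{Atten}^{h}_{ij}=\mathrm{MLP}_3\big((W_q^s\sigma_i\odot W_k^s\sigma_j)\Vert \mathrm{diagonal}(W_q^v\nu_i^T\nu_jW_k^v)\big)_h$, $h=1,\dots,H$; 3. the update $s_i\leftarrow \mathrm{MLP}_4\big(s_i'\Vert \sum_j \mathrm{Atten}_{ij}s_j'\big)$, $\;v_i\leftarrow \big(v_i'\Vert \sum_j \mathrm{Atten}_{ij}v_j'\big)W_5$, where the sums for all heads are concatenated. In the standard PST, $g_i=s_i$ and $(\sigma_i,\nu_i)=(s_i',v_i')$; in the weakened PST, $g_i=s_i'$ and $(\sigma_i,\nu_i)=(s_i,v_i)$. **Theorem.** For the standard and for the weakened PST: a one-layer PST can count paths of length $1$ and $2$, a two-layer PST can count paths of length $3$ and $4$, and a four-layer PST can count paths of length $5$ and $6$. Here "a $K$-layer PST can count paths of length $L$" means: for all $N$ and $m$ there are $d\ge m$, $H\ge1$, an eigenvalue function $f$ and parameters of $K$ layers such that, for every graph with at most $N$ nodes, all node features in $\mathbb{R}^m$, every eigendecomposition $(U,\Lambda)$ of $A$ as above, and all nodes $i\ne j$, the $(i,j)$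 element of the attention matrix of the last layer (of every head) equals the number of paths of length $L$ from $i$ to $j$. -/

import Mathlib

open scoped Matrix

universe u

/-- `IsMLP F`: the map `F : ℝ^ι → ℝ^κ` is a multi-layer perceptron with ReLU activation, with any
number of hidden layers, of any widths. -/
inductive IsMLP {κ : Type} : {ι : Type} → ((ι → ℝ) → (κ → ℝ)) → Prop
  | affine {ι : Type} [Fintype ι] (W : Matrix κ ι ℝ) (b : κ → ℝ) :
      IsMLP (fun x : ι → ℝ => W *ᵥ x + b)
  | hidden {ι : Type} [Fintype ι] {h : ℕ} (W : Matrix (Fin h) ι ℝ) (b : Fin h → ℝ)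
      {F : (Fin h → ℝ) → (κ → ℝ)} (hF : IsMLP F) :
      IsMLP (fun x : ι → ℝ => F (fun a => max 0 ((W *ᵥ x + b) a)))

/-- A `d`-channel eigenvalue function: for every rank `r` a continuous, permutation-equivariant map
`ℝ^r → ℝ^{r × d}`. -/
structure EigenvalueFunction (d : ℕ) where
  toFun : (r : ℕ) → (Fin r → ℝ) → Fin r → Fin d → ℝ
  equivariant : ∀ (r : ℕ) (σ : Equiv.Perm (Fin r)) (Λ : Fin r → ℝ),
    toFun r (Λ ∘ σ) = toFun r Λ ∘ σ
  continuous : ∀ r : ℕ, Continuous (toFun r)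

/-- `Λ` lists the non-zero eigenvalues (with multiplicity) of the real symmetric matrix `A`, and the
columns of `U` are corresponding orthonormal eigenvectors: `A = U diag(Λ) Uᵀ`. -/
structure IsEigendecomposition {V : Type*} [Fintype V] (A : Matrix V V ℝ) {r : ℕ}
    (U : Matrix V (Fin r) ℝ) (Λ : Fin r → ℝ) : Prop where
  orthonormal : Uᵀ * U = 1
  ne_zero : ∀ k, Λ k ≠ 0
  eq : A = U * Matrix.diagonal Λ * Uᵀ

/-- The parameterized coordinate of node `i`, an `r × d` matrix: its channel `c` is the `i`-th row
of `U diag(f_c(Λ))`. -/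
def psrd {V : Type*} {r d : ℕ} (f : EigenvalueFunction d) (U : Matrix V (Fin r) ℝ)
    (Λ : Fin r → ℝ) (i : V) : Matrix (Fin r) (Fin d) ℝ :=
  Matrix.of fun k c => U i k * f.toFun r Λ k c

/-- Scalar representations `s i ∈ ℝ^d` and vector representations `v i ∈ ℝ^{r × d}` of points. -/
structure PointRep (V : Type*) (r d : ℕ) where
  s : V → Fin d → ℝ
  v : V → Matrix (Fin r) (Fin d) ℝ

/-- The two versions of the architecture. -/
inductive PSTVersion
  /-- Queries and keys are computed from the features after the scalar-vector mixer, and the gate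
  of the mixer from the scalars before the mixer. -/
  | standard
  /-- Queries and keys are computed from the features before the scalar-vector mixer, and the gate
  of the mixer from the updated scalars. -/
  | weakened

/-- The learnable parameters of one layer with hidden dimension `d` and `H` attention heads. -/
structure PSTLayer (d H : ℕ) where
  W₁ : Matrix (Fin d) (Fin d) ℝ
  W₂ : Matrix (Fin d) (Fin d) ℝ
  W₃ : Matrix (Fin d) (Fin d) ℝ
  W₄ : Matrix (Fin d) (Fin d) ℝ
  Wqs : Matrix (Fin d) (Fin d) ℝ
  Wks : Matrix (Fin d) (Fin d) ℝ
  Wqv : Matrix (Fin d) (Fin d) ℝ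
  Wkv : Matrix (Fin d) (Fin d) ℝ
  W₅ : Matrix (Fin d ⊕ Fin H × Fin d) (Fin d) ℝ
  mlp₁ : (Fin d ⊕ Fin d → ℝ) → (Fin d → ℝ)
  mlp₂ : (Fin d → ℝ) → (Fin d → ℝ)
  mlp₃ : (Fin d ⊕ Fin d → ℝ) → (Fin H → ℝ)
  mlp₄ : (Fin d ⊕ Fin H × Fin d → ℝ) → (Fin d → ℝ)
  isMLP₁ : IsMLP mlp₁
  isMLP₂ : IsMLP mlp₂
  isMLP₃ : IsMLP mlp₃
  isMLP₄ : IsMLP mlp₄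

namespace PSTLayer

variable {V : Type*} {r d H : ℕ}

/-- Scalar-vector mixer: `s'_i = MLP₁(s_i ‖ diagonal(W₁ v_iᵀ v_i W₂))` and
`v'_i = v_i diag(MLP₂(g_i)) W₃ + v_i W₄`, with gate input `g_i = s_i` or `g_i = s'_i`. -/
def mixer (ℓ : PSTLayer d H) (ver : PSTVersion) (x : PointRep V r d) : PointRep V r d :=
  let s' : V → Fin d → ℝ := fun i =>
    ℓ.mlp₁ (Sum.elim (x.s i) (Matrix.diag (ℓ.W₁ * (x.v i)ᵀ * x.v i * ℓ.W₂)))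
  let g : V → Fin d → ℝ := match ver with
    | .standard => x.s
    | .weakened => s'
  { s := s'
    v := fun i => x.v i * Matrix.diagonal (ℓ.mlp₂ (g i)) * ℓ.W₃ + x.v i * ℓ.W₄ }

/-- The attention matrices with queries and keys taken from `y`; one matrix for each head `h`:
`MLP₃((W_q^s s_i ⊙ W_k^s s_j) ‖ diagonal(W_q^v v_iᵀ v_j W_k^v))`. -/
def scores (ℓ : PSTLayer d H) (y : PointRep V r d) (h : Fin H) : Matrix V V ℝ :=
  Matrix.of fun i j =>
    ℓ.mlp₃ (Sum.elim ((ℓ.Wqs *ᵥ y.s i) * (ℓ.Wks *ᵥ y.s j))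
      (Matrix.diag (ℓ.Wqv * (y.v i)ᵀ * y.v j * ℓ.Wkv))) h

/-- The attention matrices of a layer with input `x`. -/
def attention (ℓ : PSTLayer d H) (ver : PSTVersion) (x : PointRep V r d) (h : Fin H) :
    Matrix V V ℝ :=
  match ver with
  | .standard => ℓ.scores (ℓ.mixer ver x) h
  | .weakened => ℓ.scores x h

/-- The output of a layer with input `x`:
`s_i ← MLP₄(s'_i ‖ ∑_j Atten_ij s'_j)` and `v_i ← (v'_i ‖ ∑_j Atten_ij v'_j) W₅`, where the sums for
all heads are concatenated. -/
def output [Fintype V] (ℓ : PSTLayer d H) (ver : PSTVersion) (x : PointRep V r d) :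
    PointRep V r d :=
  let x' := ℓ.mixer ver x
  { s := fun i => ℓ.mlp₄ (Sum.elim (x'.s i)
      (fun p => ∑ j, ℓ.attention ver x p.1 i j * x'.s j p.2))
    v := fun i => Matrix.fromCols (x'.v i)
      (Matrix.of fun k p => ∑ j, ℓ.attention ver x p.1 i j * x'.v j k p.2) * ℓ.W₅ }

end PSTLayer

/-- A Point Set Transformer of hidden dimension `d` with `H` heads in each layer: an eigenvalue
function, which produces the coordinates, the layers before the last one (the first layer comes
first in the list), and the last layer. -/
structure PST (d H : ℕ) where
  f : EigenvalueFunction d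
  front : List (PSTLayer d H)
  last : PSTLayer d H

namespace PST

variable {V : Type*} {r d H m : ℕ}

/-- The number of layers. -/
def depth (P : PST d H) : ℕ := P.front.length + 1

/-- Initialization: the scalars are the node features, padded with zeros up to dimension `d`, and
the vectors are the parameterized coordinates. -/
def init (P : PST d H) (X : V → Fin m → ℝ) (U : Matrix V (Fin r) ℝ) (Λ : Fin r → ℝ) :
    PointRep V r d where
  s := fun i c => if hc : c.val < m then X i ⟨c.val, hc⟩ else 0
  v := psrd P.f U Λ

/-- The attention matrices of the last layer, one for each head, on the graph with node features
`X` and with adjacency matrix decomposed by `U` and `Λ`. -/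
def lastAttention [Fintype V] (P : PST d H) (ver : PSTVersion) (X : V → Fin m → ℝ)
    (U : Matrix V (Fin r) ℝ) (Λ : Fin r → ℝ) (h : Fin H) : Matrix V V ℝ :=
  P.last.attention ver (P.front.foldl (fun x ℓ => ℓ.output ver x) (P.init X U Λ)) h

end PST

/-- The number of paths of length `L` (all nodes different) from `i` to `j` in `G`. -/
noncomputable def pathCount {V : Type*} (G : SimpleGraph V) (L : ℕ) (i j : V) : ℕ :=
  Nat.card {p : G.Path i j // p.val.length = L}

/-- A Point Set Transformer with `K` layers can count paths of length `L`: for all bounds `N`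
on the number of nodes and all dimensions `m` of node features there are a hidden dimension `d ≥ m`,
a positive number `H` of heads, and parameters such that, on every simple graph with at most `N`
nodes and with arbitrary node features, and whatever eigendecomposition of the adjacency matrix is
used, the `(i, j)` element of the attention matrix of the last layer (for every head) is the number
of paths of length `L` between the distinct nodes `i` and `j`. -/
def CanCountPaths (ver : PSTVersion) (K L : ℕ) : Prop :=
  ∀ N m : ℕ, ∃ (d H : ℕ) (P : PST d H), m ≤ d ∧ 0 < H ∧ P.depth = K ∧
    ∀ (V : Type u) [Fintype V] (G : SimpleGraph V) [DecidableRel G.Adj],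
      Fintype.card V ≤ N →
      ∀ (X : V → Fin m → ℝ) (r : ℕ) (U : Matrix V (Fin r) ℝ) (Λ : Fin r → ℝ),
        IsEigendecomposition (G.adjMatrix ℝ) U Λ →
        ∀ (h : Fin H) (i j : V), i ≠ j →
          P.lastAttention ver X U Λ h i j = (pathCount G L i j : ℝ)

/-! An attention head sees scalars only through products and vectors only through inner products.
Let the vectors of node `i` be the `i`-th rows of `M U Λᵖ` for integer matrices `M`. Since `U Λᵖ Uᵀ
= Aᵖ` for `p ≥ 1`, the inner products of these rows are the entries of `M Aᵖ M'ᵀ`. They are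
integers, bounded in terms of `N` when `M` and `M'` are, and they do not depend on the
eigendecomposition. A ReLU network reproduces every function of finitely many bounded integers
exactly (`exists_isMLP_interpolation`). So an attention matrix can be any `F` that is determined by
these numbers, and a layer can pass from `M` to `F diag(φ) M` and from `φ` to `∑ j, F i j * φ j`.
These rules generate the features `FeatureLevel.level q k`. By `exists_front` and
`canCountPaths_of_isPair`, a pair feature of level `k` is the last attention matrix of a PST with `k
+ 1` layers, in both versions. No network has to be written down afterwards.

The rest is counting. A path count is a sum over distinct inner vertices of a product of entries of
`A`. Summing out a vertex between `x` and `y` leaves `(A²) x y` minus the terms in which it meets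
another vertex. For length 4 this is done to the middle vertex, for length 5 to the two vertices
next to the ends, which leaves `middleSum` with weight `A` on the middle edge. For length 6 the
middle vertex goes first: this gives `middleSum` with weight `A²`, minus the cases in which the
middle vertex equals an end (a triangle attached to a path of length 3, `triangleSum`) or a neighbor
of an end on the path (an edge attached to a path of length 4, `pendantSum`).

After expansion with `A x x = 0` and `A x y * A x y = A x y`, every term can be summed one vertex at
a time. A sum `∑ b, F i b * φ b * (Aᵖ) b j` costs one layer (`OffPair.dsum_node_pow`), so the layers
needed can be read off each term. -/

/-! ### Exact interpolation by ReLU networks on bounded integers -/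

/-- Every function on `{0, …, M}` is a constant plus a combination of the ReLU functions
`t ↦ max 0 (t - k)`. -/
theorem exists_relu_interpolation (h : ℕ → ℝ) (M : ℕ) :
    ∃ c : ℕ → ℝ, ∀ t ≤ M, h t = h 0 + ∑ k ∈ Finset.range M, c k * max 0 ((t : ℝ) - k) := by
  induction M with
  | zero =>
    refine ⟨0, fun t ht => ?_⟩
    obtain rfl : t = 0 := by omega
    simp
  | succ M ih =>
    obtain ⟨c, hc⟩ := ih
    have hsum : ∀ v x : ℝ, ∑ k ∈ Finset.range M, Function.update c M v k * max 0 (x - k) =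
        ∑ k ∈ Finset.range M, c k * max 0 (x - k) := fun v x =>
      Finset.sum_congr rfl fun k hk => by
        rw [Function.update_of_ne (Finset.mem_range.mp hk).ne]
    -- The new function `max 0 (t - M)` is `0` for `t ≤ M` and `1` at `t = M + 1`, so its
    -- coefficient is the error at `M + 1`.
    refine ⟨Function.update c M (h (M + 1) - h 0 -
      ∑ k ∈ Finset.range M, c k * max 0 (((M + 1 : ℕ) : ℝ) - k)), fun t ht => ?_⟩
    rw [Finset.sum_range_succ, hsum, Function.update_self]
    rcases Nat.lt_or_ge M t with h1 | h1
    · obtain rfl : t = M + 1 := by omega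
      simp
    · have : max 0 ((t : ℝ) - M) = 0 := by
        rw [max_eq_left]
        have : (t : ℝ) ≤ M := by exact_mod_cast h1
        linarith
      rw [this, hc t h1]
      simp

/-- An MLP can compute any function of finitely many bounded integer coordinates of its input. -/
theorem exists_isMLP_interpolation {ι κ γ : Type} [Fintype ι] [Fintype γ] (sel : γ → ι)
    (B : ℕ) (g : (γ → ℤ) → κ → ℝ) :
    ∃ F : (ι → ℝ) → (κ → ℝ), IsMLP F ∧ ∀ (x : ι → ℝ) (z : γ → ℤ), (∀ c, x (sel c) = z c) →
      (∀ c, |z c| ≤ B) → F x = g z := by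
  classical
  let e := Fintype.equivFin γ
  let n := Fintype.card γ
  -- Shifted by `B`, the coordinates lie in `{0, …, 2B}`. Read as digits in base `2B + 1` they form
  -- a single integer below `m ^ n`, which is affine in the input; one hidden layer interpolates
  -- over it.
  let m := 2 * B + 1
  let code : (Fin n → Fin m) ≃ Fin (m ^ n) := finFunctionFinEquiv
  let h : κ → ℕ → ℝ := fun a t =>
    if ht : t < m ^ n then g (fun c => ((code.symm ⟨t, ht⟩ (e c) : ℕ) : ℤ) - B) a else 0
  choose c hc using fun a => exists_relu_interpolation (h a) (m ^ n)
  -- `sel` need not be injective, so a coordinate may serve as several digits.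
  let W : Matrix (Fin (m ^ n)) ι ℝ :=
    Matrix.of fun _ x => ∑ y, if sel y = x then (m : ℝ) ^ (e y : ℕ) else 0
  let b : Fin (m ^ n) → ℝ := fun k => (∑ y, (B : ℝ) * (m : ℝ) ^ (e y : ℕ)) - (k : ℕ)
  refine ⟨_, IsMLP.hidden W b (IsMLP.affine (Matrix.of fun a (k : Fin (m ^ n)) => c a k)
    (fun a => h a 0)), fun x z hx hz => ?_⟩
  let w : Fin n → Fin m := fun i => ⟨(z (e.symm i) + B).toNat, by
    have := abs_le.mp (hz (e.symm i)); omega⟩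
  have hw : ∀ y, (((w (e y) : Fin m) : ℕ) : ℤ) = z y + B := fun y => by
    have := abs_le.mp (hz y)
    simp only [w, Equiv.symm_apply_apply]
    omega
  have hW : ∀ k, (W *ᵥ x + b) k = ((code w : Fin (m ^ n)) : ℕ) - (k : ℕ) := fun k => by
    have h1 : (W *ᵥ x) k = ∑ y, x (sel y) * (m : ℝ) ^ (e y : ℕ) := by
      simp only [W, Matrix.mulVec, dotProduct, Matrix.of_apply, Finset.sum_mul]
      rw [Finset.sum_comm]
      refine Finset.sum_congr rfl fun y _ => ?_
      simp [mul_comm]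
    have h2 : (((code w : Fin (m ^ n)) : ℕ) : ℝ) =
        ∑ y, (x (sel y) + B) * (m : ℝ) ^ (e y : ℕ) := by
      rw [finFunctionFinEquiv_apply, ← e.sum_comp]
      push_cast
      refine Finset.sum_congr rfl fun y _ => ?_
      have : (((w (e y) : Fin m) : ℕ) : ℝ) = x (sel y) + B := by
        rw [hx y]; exact_mod_cast hw y
      rw [this]
    rw [Pi.add_apply, h1, h2]
    simp only [b, add_mul, Finset.sum_add_distrib]
    ring
  funext a
  have hcode := (code w).isLt
  have h3 := hc a (code w) hcode.le
  have h4 : h a (code w) = g z a := by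
    simp only [h, dif_pos hcode, Fin.eta, Equiv.symm_apply_apply]
    congr 1
    funext y
    rw [hw y]; ring
  rw [← h4, h3]
  simp only [hW, Pi.add_apply, Matrix.mulVec, dotProduct, Matrix.of_apply]
  rw [add_comm, Finset.sum_range]

/-! ### Integer features of nodes and pairs, and the levels that layers reach -/

/-- A graph with at most `N` nodes, node features in `ℝ^m` and an eigendecomposition of its
adjacency matrix. -/
structure GraphInput (N m : ℕ) : Type (u + 1) where
  V : Type u
  [fintype : Fintype V]
  [decEq : DecidableEq V]
  G : SimpleGraph V
  [decAdj : DecidableRel G.Adj]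
  card_le : Fintype.card V ≤ N
  X : V → Fin m → ℝ
  r : ℕ
  U : Matrix V (Fin r) ℝ
  Λ : Fin r → ℝ
  eig : IsEigendecomposition (G.adjMatrix ℝ) U Λ

attribute [instance] GraphInput.fintype GraphInput.decEq GraphInput.decAdj

/-- An integer attached to every node of every input. -/
abbrev NodeFeature (N m : ℕ) := (I : GraphInput.{u} N m) → I.V → ℤ

/-- An integer attached to every pair of nodes of every input. -/
abbrev PairFeature (N m : ℕ) := (I : GraphInput.{u} N m) → Matrix I.V I.V ℤ

section Features

variable {N m : ℕ}

/-- The adjacency matrix. -/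
def adj : PairFeature.{u} N m := fun I => I.G.adjMatrix ℤ

/-- The inner products `M Aᵖ M'ᵀ` of two families of vectors. -/
def gram (M : PairFeature.{u} N m) (p : ℕ) (M' : PairFeature.{u} N m) : PairFeature.{u} N m :=
  fun I => M I * (adj I) ^ p * (M' I)ᵀ

theorem adj_transpose (I : GraphInput.{u} N m) : (adj I)ᵀ = adj I :=
  SimpleGraph.transpose_adjMatrix I.G

theorem gram_transpose (M : PairFeature.{u} N m) (p : ℕ) (M' : PairFeature.{u} N m)
    (I : GraphInput.{u} N m) : (gram M p M' I)ᵀ = gram M' p M I := by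
  simp [gram, Matrix.transpose_mul, Matrix.transpose_pow, adj_transpose, Matrix.mul_assoc]

/-- `F i j` is a function of the products `σ i * τ j` with `σ, τ ∈ S` and of the inner products
`(M Aᵖ M'ᵀ) i j` with `M, M' ∈ T` and `1 ≤ p ≤ q`. -/
def PairDetermined (q : ℕ) (S : Set (NodeFeature.{u} N m)) (T : Set (PairFeature.{u} N m))
    (F : PairFeature.{u} N m) : Prop :=
  ∀ (I I' : GraphInput.{u} N m) (i j : I.V) (i' j' : I'.V),
    (∀ σ ∈ S, ∀ τ ∈ S, σ I i * τ I j = σ I' i' * τ I' j') →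
    (∀ M ∈ T, ∀ M' ∈ T, ∀ p, 1 ≤ p → p ≤ q → gram M p M' I i j = gram M p M' I' i' j') →
    F I i j = F I' i' j'

/-- `φ i` is a function of the `σ i` with `σ ∈ S` and of the inner products `(M Aᵖ M'ᵀ) i i` with
`M, M' ∈ T` and `1 ≤ p ≤ q`. -/
def NodeDetermined (q : ℕ) (S : Set (NodeFeature.{u} N m)) (T : Set (PairFeature.{u} N m))
    (φ : NodeFeature.{u} N m) : Prop :=
  ∀ (I I' : GraphInput.{u} N m) (i : I.V) (i' : I'.V),
    (∀ σ ∈ S, σ I i = σ I' i') →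
    (∀ M ∈ T, ∀ M' ∈ T, ∀ p, 1 ≤ p → p ≤ q → gram M p M' I i i = gram M p M' I' i' i') →
    φ I i = φ I' i'

theorem PairDetermined.mono {q : ℕ} {S S' : Set (NodeFeature.{u} N m)}
    {T T' : Set (PairFeature.{u} N m)} {F : PairFeature.{u} N m} (h : PairDetermined q S T F)
    (hS : S ⊆ S') (hT : T ⊆ T') : PairDetermined q S' T' F :=
  fun I I' i j i' j' h1 h2 => h I I' i j i' j'
    (fun σ hσ τ hτ => h1 σ (hS hσ) τ (hS hτ)) (fun M hM M' hM' => h2 M (hT hM) M' (hT hM'))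

theorem NodeDetermined.mono {q : ℕ} {S S' : Set (NodeFeature.{u} N m)}
    {T T' : Set (PairFeature.{u} N m)} {φ : NodeFeature.{u} N m} (h : NodeDetermined q S T φ)
    (hS : S ⊆ S') (hT : T ⊆ T') : NodeDetermined q S' T' φ :=
  fun I I' i i' h1 h2 => h I I' i i'
    (fun σ hσ => h1 σ (hS hσ)) (fun M hM M' hM' => h2 M (hT hM) M' (hT hM'))

/-- The node features and the matrices `M` (with vector representations `M U Λᵖ`) that are
available after some number of layers. -/
structure FeatureLevel (N m : ℕ) where
  node : Set (NodeFeature.{u} N m)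
  mat : Set (PairFeature.{u} N m)

namespace FeatureLevel

/-- The statement `P` holds for finitely many features of the level `L`. -/
def Finitely (L : FeatureLevel.{u} N m)
    (P : Set (NodeFeature.{u} N m) → Set (PairFeature.{u} N m) → Prop) : Prop :=
  ∃ S T, S.Finite ∧ S ⊆ L.node ∧ T.Finite ∧ T ⊆ L.mat ∧ P S T

/-- Pair features that an attention matrix can compute at level `L`. -/
def IsPair (L : FeatureLevel.{u} N m) (q : ℕ) (F : PairFeature.{u} N m) : Prop :=
  L.Finitely fun S T => PairDetermined q S T F

/-- Node features that a mixer can compute at level `L`. -/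
def IsNode (L : FeatureLevel.{u} N m) (q : ℕ) (φ : NodeFeature.{u} N m) : Prop :=
  L.Finitely fun S T => NodeDetermined q S T φ

/-- The features available one layer later. -/
def next (L : FeatureLevel.{u} N m) (q : ℕ) : FeatureLevel.{u} N m where
  node := {σ | ∃ φ₀ F φ, L.IsNode q φ₀ ∧ L.IsPair q F ∧ L.IsNode q φ ∧
    ∀ I i, σ I i = φ₀ I i + ∑ j, F I i j * φ I j}
  mat := {M | ∃ (c : ℤ) (M₀ M₁ F : PairFeature.{u} N m) (φ : NodeFeature.{u} N m),
    M₀ ∈ L.mat ∧ M₁ ∈ L.mat ∧ L.IsPair q F ∧ L.IsNode q φ ∧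
    ∀ I, M I = c • M₀ I + F I * Matrix.diagonal (φ I) * M₁ I}

/-- The features available after `k` layers. -/
def level (q : ℕ) : ℕ → FeatureLevel.{u} N m
  | 0 => ⟨∅, {1}⟩
  | k + 1 => (level q k).next q

theorem Finitely.imp {L : FeatureLevel.{u} N m}
    {P Q : Set (NodeFeature.{u} N m) → Set (PairFeature.{u} N m) → Prop}
    (h : L.Finitely P) (hPQ : ∀ S T, P S T → Q S T) : L.Finitely Q := by
  obtain ⟨S, T, h1, h2, h3, h4, h5⟩ := h
  exact ⟨S, T, h1, h2, h3, h4, hPQ S T h5⟩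

theorem Finitely.forall {L : FeatureLevel.{u} N m} {ι : Type*} [Finite ι]
    {P : ι → Set (NodeFeature.{u} N m) → Set (PairFeature.{u} N m) → Prop}
    (hP : ∀ x S S' T T', S ⊆ S' → T ⊆ T' → P x S T → P x S' T')
    (h : ∀ x, L.Finitely (P x)) : L.Finitely fun S T => ∀ x, P x S T := by
  choose S T h1 h2 h3 h4 h5 using h
  exact ⟨⋃ x, S x, ⋃ x, T x, Set.finite_iUnion h1, Set.iUnion_subset h2, Set.finite_iUnion h3,
    Set.iUnion_subset h4, fun x => hP x _ _ _ _ (Set.subset_iUnion S x)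
      (Set.subset_iUnion T x) (h5 x)⟩

theorem Finitely.and {L : FeatureLevel.{u} N m}
    {P Q : Set (NodeFeature.{u} N m) → Set (PairFeature.{u} N m) → Prop}
    (hP : ∀ S S' T T', S ⊆ S' → T ⊆ T' → P S T → P S' T')
    (hQ : ∀ S S' T T', S ⊆ S' → T ⊆ T' → Q S T → Q S' T')
    (h : L.Finitely P) (h' : L.Finitely Q) : L.Finitely fun S T => P S T ∧ Q S T := by
  obtain ⟨S, T, h1, h2, h3, h4, h5⟩ := h
  obtain ⟨S', T', h1', h2', h3', h4', h5'⟩ := h'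
  exact ⟨S ∪ S', T ∪ T', h1.union h1', Set.union_subset h2 h2', h3.union h3',
    Set.union_subset h4 h4', hP _ _ _ _ Set.subset_union_left Set.subset_union_left h5,
    hQ _ _ _ _ Set.subset_union_right Set.subset_union_right h5'⟩

theorem IsPair.and {L : FeatureLevel.{u} N m} {q : ℕ} {F G : PairFeature.{u} N m}
    (hF : L.IsPair q F) (hG : L.IsPair q G) :
    L.Finitely fun S T => PairDetermined q S T F ∧ PairDetermined q S T G :=
  Finitely.and (fun _ _ _ _ h1 h2 h => h.mono h1 h2) (fun _ _ _ _ h1 h2 h => h.mono h1 h2) hF hG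

theorem IsNode.and {L : FeatureLevel.{u} N m} {q : ℕ} {φ ψ : NodeFeature.{u} N m}
    (hφ : L.IsNode q φ) (hψ : L.IsNode q ψ) :
    L.Finitely fun S T => NodeDetermined q S T φ ∧ NodeDetermined q S T ψ :=
  Finitely.and (fun _ _ _ _ h1 h2 h => h.mono h1 h2) (fun _ _ _ _ h1 h2 h => h.mono h1 h2) hφ hψ

theorem IsPair.and_isNode {L : FeatureLevel.{u} N m} {q : ℕ} {F : PairFeature.{u} N m}
    {φ : NodeFeature.{u} N m} (hF : L.IsPair q F) (hφ : L.IsNode q φ) :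
    L.Finitely fun S T => PairDetermined q S T F ∧ NodeDetermined q S T φ :=
  Finitely.and (fun _ _ _ _ h1 h2 h => h.mono h1 h2) (fun _ _ _ _ h1 h2 h => h.mono h1 h2) hF hφ

variable {L : FeatureLevel.{u} N m} {q : ℕ}

theorem IsPair.map₂ {F G : PairFeature.{u} N m} (op : ℤ → ℤ → ℤ) (hF : L.IsPair q F)
    (hG : L.IsPair q G) : L.IsPair q (fun I => Matrix.of fun i j => op (F I i j) (G I i j)) :=
  (hF.and hG).imp fun S T h I I' i j i' j' h1 h2 => by
    simp only [Matrix.of_apply]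
    rw [h.1 I I' i j i' j' h1 h2, h.2 I I' i j i' j' h1 h2]

theorem IsNode.map₂ {φ ψ : NodeFeature.{u} N m} (op : ℤ → ℤ → ℤ) (hφ : L.IsNode q φ)
    (hψ : L.IsNode q ψ) : L.IsNode q (fun I i => op (φ I i) (ψ I i)) :=
  (hφ.and hψ).imp fun S T h I I' i i' h1 h2 => by
    show op (φ I i) (ψ I i) = op (φ I' i') (ψ I' i')
    rw [h.1 I I' i i' h1 h2, h.2 I I' i i' h1 h2]

theorem isPair_const (c : ℤ) : L.IsPair q (fun _ => Matrix.of fun _ _ => c) :=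
  ⟨∅, ∅, Set.finite_empty, Set.empty_subset _, Set.finite_empty, Set.empty_subset _,
    fun _ _ _ _ _ _ _ _ => rfl⟩

theorem isNode_const (c : ℤ) : L.IsNode q (fun _ _ => c) :=
  ⟨∅, ∅, Set.finite_empty, Set.empty_subset _, Set.finite_empty, Set.empty_subset _,
    fun _ _ _ _ _ _ => rfl⟩

/-- The data on which a pair feature depends are closed under exchanging `i` and `j`: products
commute, and `gram M p M'` transposes to `gram M' p M` because `A` is symmetric. -/
theorem IsPair.transpose {F : PairFeature.{u} N m} (hF : L.IsPair q F) :
    L.IsPair q (fun I => (F I)ᵀ) :=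
  Finitely.imp hF fun S T h I I' i j i' j' h1 h2 => by
    simp only [Matrix.transpose_apply]
    refine h I I' j i j' i' (fun σ hσ τ hτ => ?_) fun M hM M' hM' p hp hp' => ?_
    · rw [mul_comm, h1 τ hτ σ hσ, mul_comm]
    · have := h2 M' hM' M hM p hp hp'
      rwa [← gram_transpose M p M', ← gram_transpose M p M'] at this

theorem isPair_gram {M M' : PairFeature.{u} N m} (hM : M ∈ L.mat) (hM' : M' ∈ L.mat) {p : ℕ}
    (hp : 1 ≤ p) (hpq : p ≤ q) : L.IsPair q (gram M p M') :=
  ⟨∅, {M, M'}, Set.finite_empty, Set.empty_subset _, Set.toFinite _, by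
    rintro x (rfl | rfl) <;> assumption,
    fun _ _ _ _ _ _ _ h => h M (by simp) M' (by simp) p hp hpq⟩

theorem isNode_of_mem {σ : NodeFeature.{u} N m} (hσ : σ ∈ L.node) : L.IsNode q σ :=
  ⟨{σ}, ∅, Set.finite_singleton _, by simpa using hσ, Set.finite_empty, Set.empty_subset _,
    fun _ _ _ _ h _ => h σ rfl⟩

theorem IsPair.mul_nodes {σ τ : NodeFeature.{u} N m} (hσ : σ ∈ L.node) (hτ : τ ∈ L.node) :
    L.IsPair q (fun I => Matrix.of fun i j => σ I i * τ I j) :=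
  ⟨{σ, τ}, ∅, Set.toFinite _, by rintro x (rfl | rfl) <;> assumption, Set.finite_empty,
    Set.empty_subset _, fun _ _ _ _ _ _ h _ => h σ (by simp) τ (by simp)⟩

/-- A diagonal entry of a pair feature is a node feature. -/
theorem IsPair.diag {F : PairFeature.{u} N m} (hF : L.IsPair q F) :
    L.IsNode q (fun I i => F I i i) :=
  Finitely.imp hF fun S T h I I' i i' h1 h2 =>
    h I I' i i i' i' (fun σ hσ τ hτ => by rw [h1 σ hσ, h1 τ hτ]) h2

theorem IsNode.mem_next {φ : NodeFeature.{u} N m} (hφ : L.IsNode q φ) : φ ∈ (L.next q).node :=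
  ⟨φ, _, φ, hφ, isPair_const 0, hφ, fun I i => by simp⟩

theorem IsPair.sum_mem_next {F : PairFeature.{u} N m} {φ : NodeFeature.{u} N m}
    (hF : L.IsPair q F) (hφ : L.IsNode q φ) :
    (fun I i => ∑ j, F I i j * φ I j) ∈ (L.next q).node :=
  ⟨_, F, φ, isNode_const 0, hF, hφ, fun I i => by simp⟩

theorem mem_next_mat {M : PairFeature.{u} N m} (hM : M ∈ L.mat) : M ∈ (L.next q).mat :=
  ⟨1, M, M, _, _, hM, hM, isPair_const 0, isNode_const 0, fun I => by
    simp [show (Matrix.of fun _ _ => 0 : Matrix I.V I.V ℤ) = 0 from rfl]⟩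

theorem IsPair.mul_mem_next {F M : PairFeature.{u} N m} {φ : NodeFeature.{u} N m}
    (hF : L.IsPair q F) (hφ : L.IsNode q φ) (hM : M ∈ L.mat) :
    (fun I => F I * Matrix.diagonal (φ I) * M I) ∈ (L.next q).mat :=
  ⟨0, M, M, F, φ, hM, hM, hF, hφ, fun I => by simp⟩

/-- At level `0` the scalars are unknown real node features and no scalar is usable; a constant
first appears after one layer. -/
theorem one_mem_next_node : (fun _ _ => 1) ∈ (L.next q).node := (isNode_const 1).mem_next

/-- Attention sees scalars only as products `σ i * τ j`; the factor `τ = 1` isolates `σ i`. -/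
theorem isPair_left_of_mem_next {σ : NodeFeature.{u} N m} (hσ : σ ∈ (L.next q).node) :
    (L.next q).IsPair q (fun I => Matrix.of fun i _ => σ I i) := by
  simpa using IsPair.mul_nodes (q := q) hσ one_mem_next_node

theorem IsPair.next {F : PairFeature.{u} N m} (hF : L.IsPair q F)
    (hL : ∀ σ ∈ L.node, σ ∈ (L.next q).node) : (L.next q).IsPair q F := by
  obtain ⟨S, T, h1, h2, h3, h4, h5⟩ := hF
  exact ⟨S, T, h1, fun σ hσ => hL σ (h2 hσ), h3, fun M hM => mem_next_mat (h4 hM), h5⟩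

theorem IsPair.level_succ {F : PairFeature.{u} N m} {k : ℕ} (hF : (level q k).IsPair q F) :
    (level q (k + 1)).IsPair q F :=
  hF.next fun _ hσ => (isNode_of_mem hσ).mem_next

theorem one_mem_level_mat (k : ℕ) : (1 : PairFeature.{u} N m) ∈ (level q k).mat := by
  induction k with
  | zero => exact rfl
  | succ k ih => exact mem_next_mat ih

end FeatureLevel

/-! ### Bounds that are uniform over all graphs with at most `N` nodes -/

theorem abs_sum_le_of_card_le {V : Type*} [Fintype V] (hV : Fintype.card V ≤ N) (f : V → ℤ)
    (B : ℕ) (hf : ∀ i, |f i| ≤ B) : |∑ i, f i| ≤ ((N * B : ℕ) : ℤ) :=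
  calc |∑ i, f i| ≤ ∑ i, |f i| := Finset.abs_sum_le_sum_abs _ _
    _ ≤ ∑ _i : V, (B : ℤ) := Finset.sum_le_sum fun i _ => hf i
    _ = (Fintype.card V * B : ℕ) := by simp
    _ ≤ _ := by exact_mod_cast Nat.mul_le_mul_right B hV

theorem abs_mul_le_of_abs_le {x y : ℤ} {B C : ℕ} (hx : |x| ≤ B) (hy : |y| ≤ C) :
    |x * y| ≤ ((B * C : ℕ) : ℤ) := by
  rw [abs_mul]; push_cast; gcongr

/-- Entrywise bounded pair features. -/
def PairFeature.IsBounded (F : PairFeature.{u} N m) : Prop :=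
  ∃ B : ℕ, ∀ I i j, |F I i j| ≤ (B : ℤ)

/-- Bounded node features. -/
def NodeFeature.IsBounded (φ : NodeFeature.{u} N m) : Prop :=
  ∃ B : ℕ, ∀ I i, |φ I i| ≤ (B : ℤ)

theorem PairFeature.IsBounded.mul {F G : PairFeature.{u} N m} (hF : F.IsBounded)
    (hG : G.IsBounded) : PairFeature.IsBounded (fun I => F I * G I) := by
  obtain ⟨B, hB⟩ := hF
  obtain ⟨C, hC⟩ := hG
  exact ⟨N * (B * C), fun I i j => abs_sum_le_of_card_le I.card_le _ _ fun k =>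
    abs_mul_le_of_abs_le (hB I i k) (hC I k j)⟩

theorem PairFeature.isBounded_adj : (adj : PairFeature.{u} N m).IsBounded :=
  ⟨1, fun I i j => by
    simp only [adj, SimpleGraph.adjMatrix_apply]; split_ifs <;> simp⟩

theorem PairFeature.isBounded_one : (1 : PairFeature.{u} N m).IsBounded :=
  ⟨1, fun I i j => by
    simp only [Pi.one_apply, Matrix.one_apply]; split_ifs <;> simp⟩

theorem PairFeature.IsBounded.transpose {F : PairFeature.{u} N m} (hF : F.IsBounded) :
    PairFeature.IsBounded (fun I => (F I)ᵀ) := by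
  obtain ⟨B, hB⟩ := hF
  exact ⟨B, fun I i j => hB I j i⟩

theorem PairFeature.isBounded_adj_pow (p : ℕ) :
    PairFeature.IsBounded (N := N) (m := m) (fun I : GraphInput.{u} N m => adj I ^ p) := by
  induction p with
  | zero => simpa using! PairFeature.isBounded_one
  | succ p ih => simpa only [pow_succ] using ih.mul PairFeature.isBounded_adj

theorem PairFeature.IsBounded.gram {F G : PairFeature.{u} N m} (hF : F.IsBounded)
    (hG : G.IsBounded) (p : ℕ) : (gram F p G).IsBounded :=
  (hF.mul (PairFeature.isBounded_adj_pow p)).mul hG.transpose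

/-- All features of the level are bounded. -/
structure FeatureLevel.Bounded (L : FeatureLevel.{u} N m) : Prop where
  node : ∀ σ ∈ L.node, NodeFeature.IsBounded σ
  mat : ∀ M ∈ L.mat, PairFeature.IsBounded M

section Keys

variable {α κ : Type}

/-- The values on which a determined pair feature depends. -/
def pairKey (q : ℕ) (σ : α → NodeFeature.{u} N m) (M : κ → PairFeature.{u} N m)
    (x : Σ I : GraphInput.{u} N m, I.V × I.V) : (α × α) ⊕ (κ × κ × Fin q) → ℤ :=
  Sum.elim (fun c => σ c.1 x.1 x.2.1 * σ c.2 x.1 x.2.2)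
    (fun c => gram (M c.1) (c.2.2 + 1) (M c.2.1) x.1 x.2.1 x.2.2)

/-- The values on which a determined node feature depends. -/
def nodeKey (q : ℕ) (σ : α → NodeFeature.{u} N m) (M : κ → PairFeature.{u} N m)
    (x : Σ I : GraphInput.{u} N m, I.V) : α ⊕ (κ × κ × Fin q) → ℤ :=
  Sum.elim (fun c => σ c x.1 x.2) (fun c => gram (M c.1) (c.2.2 + 1) (M c.2.1) x.1 x.2 x.2)

theorem PairDetermined.factorsThrough {q : ℕ} {σ : α → NodeFeature.{u} N m}
    {M : κ → PairFeature.{u} N m} {F : PairFeature.{u} N m}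
    (h : PairDetermined q (Set.range σ) (Set.range M) F) :
    Function.FactorsThrough
      (fun x : Σ I : GraphInput.{u} N m, I.V × I.V => F x.1 x.2.1 x.2.2) (pairKey q σ M) := by
  rintro ⟨I, i, j⟩ ⟨I', i', j'⟩ hk
  refine h I I' i j i' j' ?_ ?_
  · rintro _ ⟨a, rfl⟩ _ ⟨b, rfl⟩
    exact congrFun hk (.inl (a, b))
  · rintro _ ⟨a, rfl⟩ _ ⟨b, rfl⟩ p hp hpq
    -- The exponents `1, …, q` are indexed by `Fin q`, hence the shift.
    have := congrFun hk (.inr (a, b, ⟨p - 1, by omega⟩))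
    simpa only [pairKey, Sum.elim_inr, Nat.sub_add_cancel hp] using this

theorem NodeDetermined.factorsThrough {q : ℕ} {σ : α → NodeFeature.{u} N m}
    {M : κ → PairFeature.{u} N m} {φ : NodeFeature.{u} N m}
    (h : NodeDetermined q (Set.range σ) (Set.range M) φ) :
    Function.FactorsThrough
      (fun x : Σ I : GraphInput.{u} N m, I.V => φ x.1 x.2) (nodeKey q σ M) := by
  rintro ⟨I, i⟩ ⟨I', i'⟩ hk
  refine h I I' i i' ?_ ?_
  · rintro _ ⟨a, rfl⟩
    exact congrFun hk (.inl a)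
  · rintro _ ⟨a, rfl⟩ _ ⟨b, rfl⟩ p hp hpq
    have := congrFun hk (.inr (a, b, ⟨p - 1, by omega⟩))
    simpa only [nodeKey, Sum.elim_inr, Nat.sub_add_cancel hp] using this

theorem exists_uniform_bound {ι X : Type*} [Fintype ι] (f : X → ι → ℤ)
    (h : ∀ c, ∃ B : ℕ, ∀ x, |f x c| ≤ B) : ∃ B : ℕ, ∀ x c, |f x c| ≤ B := by
  choose B hB using h
  refine ⟨∑ c, B c, fun x c => (hB c x).trans ?_⟩
  exact_mod_cast Finset.single_le_sum (fun _ _ => Nat.zero_le _) (Finset.mem_univ c)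

theorem exists_pairKey_bound [Fintype α] [Fintype κ] (q : ℕ) {σ : α → NodeFeature.{u} N m}
    {M : κ → PairFeature.{u} N m} (hσ : ∀ a, NodeFeature.IsBounded (σ a))
    (hM : ∀ k, PairFeature.IsBounded (M k)) :
    ∃ B : ℕ, ∀ x c, |pairKey q σ M x c| ≤ B := by
  refine exists_uniform_bound _ ?_
  rintro (⟨a, b⟩ | ⟨a, b, p⟩)
  · obtain ⟨B, hB⟩ := hσ a
    obtain ⟨C, hC⟩ := hσ b
    exact ⟨B * C, fun x => abs_mul_le_of_abs_le (hB _ _) (hC _ _)⟩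
  · obtain ⟨B, hB⟩ := (hM a).gram (hM b) (p + 1)
    exact ⟨B, fun x => hB _ _ _⟩

theorem exists_nodeKey_bound [Fintype α] [Fintype κ] (q : ℕ) {σ : α → NodeFeature.{u} N m}
    {M : κ → PairFeature.{u} N m} (hσ : ∀ a, NodeFeature.IsBounded (σ a))
    (hM : ∀ k, PairFeature.IsBounded (M k)) :
    ∃ B : ℕ, ∀ x c, |nodeKey q σ M x c| ≤ B := by
  refine exists_uniform_bound _ ?_
  rintro (a | ⟨a, b, p⟩)
  · obtain ⟨B, hB⟩ := hσ a
    exact ⟨B, fun x => hB _ _⟩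
  · obtain ⟨B, hB⟩ := (hM a).gram (hM b) (p + 1)
    exact ⟨B, fun x => hB _ _ _⟩

/-- Bounded integer keys take finitely many values, so any function of them does too. This keeps
features bounded from level to level although they are arbitrary functions of earlier ones. -/
theorem exists_bound_of_factorsThrough {X γ : Type*} [Fintype γ] {key : X → γ → ℤ} {f : X → ℤ}
    (h : Function.FactorsThrough f key) {B : ℕ} (hB : ∀ x c, |key x c| ≤ B) :
    ∃ C : ℕ, ∀ x, |f x| ≤ C := by
  classical
  obtain ⟨C, hC⟩ := ((Set.finite_Icc (fun _ : γ => -(B : ℤ)) (fun _ => B)).image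
    fun z => |Function.extend key f 0 z|).bddAbove
  refine ⟨C.toNat, fun x => ?_⟩
  have h1 : key x ∈ Set.Icc (fun _ : γ => -(B : ℤ)) (fun _ => B) :=
    ⟨fun c => (abs_le.mp (hB x c)).1, fun c => (abs_le.mp (hB x c)).2⟩
  have h2 := hC (Set.mem_image_of_mem _ h1)
  simp only [h.extend_apply] at h2
  exact h2.trans (Int.self_le_toNat C)

/-- A finite set is the range of a finite family. -/
theorem Set.Finite.exists_fin_range_eq {X : Type*} {S : Set X} (hS : S.Finite) :
    ∃ (n : ℕ) (f : Fin n → X), Set.range f = S := by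
  have := hS.to_subtype
  let e := Finite.equivFin S
  exact ⟨_, fun a => (e.symm a : X), by
    rw [show (fun a => (e.symm a : X)) = Subtype.val ∘ e.symm from rfl,
      e.symm.surjective.range_comp, Subtype.range_coe]⟩

end Keys

namespace FeatureLevel

variable {L : FeatureLevel.{u} N m} {q : ℕ}

theorem Finitely.exists_families
    {P : Set (NodeFeature.{u} N m) → Set (PairFeature.{u} N m) → Prop} (h : L.Finitely P) :
    ∃ (a b : ℕ) (σ : Fin a → NodeFeature.{u} N m) (M : Fin b → PairFeature.{u} N m),
      (∀ c, σ c ∈ L.node) ∧ (∀ c, M c ∈ L.mat) ∧ P (Set.range σ) (Set.range M) := by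
  obtain ⟨S, T, h1, h2, h3, h4, h5⟩ := h
  obtain ⟨a, σ, rfl⟩ := h1.exists_fin_range_eq
  obtain ⟨b, M, rfl⟩ := h3.exists_fin_range_eq
  exact ⟨a, b, σ, M, fun c => h2 ⟨c, rfl⟩, fun c => h4 ⟨c, rfl⟩, h5⟩

theorem IsPair.isBounded {F : PairFeature.{u} N m} (hF : L.IsPair q F) (hL : L.Bounded) :
    F.IsBounded := by
  obtain ⟨a, b, σ, M, hσ, hM, h⟩ := Finitely.exists_families hF
  obtain ⟨B, hB⟩ := exists_pairKey_bound q (fun c => hL.node _ (hσ c)) fun c => hL.mat _ (hM c)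
  obtain ⟨C, hC⟩ := exists_bound_of_factorsThrough h.factorsThrough hB
  exact ⟨C, fun I i j => hC ⟨I, i, j⟩⟩

theorem IsNode.isBounded {φ : NodeFeature.{u} N m} (hφ : L.IsNode q φ) (hL : L.Bounded) :
    φ.IsBounded := by
  obtain ⟨a, b, σ, M, hσ, hM, h⟩ := Finitely.exists_families hφ
  obtain ⟨B, hB⟩ := exists_nodeKey_bound q (fun c => hL.node _ (hσ c)) fun c => hL.mat _ (hM c)
  obtain ⟨C, hC⟩ := exists_bound_of_factorsThrough h.factorsThrough hB
  exact ⟨C, fun I i => hC ⟨I, i⟩⟩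

theorem Bounded.next (hL : L.Bounded) : (L.next q).Bounded where
  node := by
    rintro σ ⟨φ₀, F, φ, h0, hF, hφ, h⟩
    obtain ⟨A, hA⟩ := h0.isBounded hL
    obtain ⟨B, hB⟩ := hF.isBounded hL
    obtain ⟨C, hC⟩ := hφ.isBounded hL
    refine ⟨A + N * (B * C), fun I i => ?_⟩
    rw [h]
    push_cast
    refine (abs_add_le _ _).trans (add_le_add (hA I i) ?_)
    exact_mod_cast abs_sum_le_of_card_le I.card_le _ (B * C) fun j =>
      abs_mul_le_of_abs_le (hB I i j) (hC I j)
  mat := by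
    rintro M ⟨c, M₀, M₁, F, φ, h0, h1, hF, hφ, h⟩
    obtain ⟨A, hA⟩ := hL.mat _ h0
    have hD : PairFeature.IsBounded (fun I => Matrix.diagonal (φ I)) := by
      obtain ⟨C, hC⟩ := hφ.isBounded hL
      refine ⟨C, fun I i j => ?_⟩
      change |Matrix.diagonal (φ I) i j| ≤ _
      rw [Matrix.diagonal_apply]
      split_ifs
      · exact hC I i
      · simp
    obtain ⟨B, hB⟩ := ((hF.isBounded hL).mul hD).mul (hL.mat _ h1)
    refine ⟨c.natAbs * A + B, fun I i j => ?_⟩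
    rw [h]
    push_cast
    refine (abs_add_le _ _).trans (add_le_add ?_ (hB I i j))
    rw [Matrix.smul_apply, smul_eq_mul, abs_mul]
    exact mul_le_mul_of_nonneg_left (hA I i j) (abs_nonneg c)

theorem bounded_level (k : ℕ) : (level q k : FeatureLevel.{u} N m).Bounded := by
  induction k with
  | zero =>
    refine ⟨fun σ hσ => hσ.elim, fun M hM => ?_⟩
    rw [Set.mem_singleton_iff.mp hM]
    exact PairFeature.isBounded_one
  | succ k ih => exact ih.next

end FeatureLevel

end Features

/-! ### Layers realize the levels -/

section Network

variable {N m d H q : ℕ} {α κ : Type}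

/-- Powers telescope through `Uᵀ U = 1`. The exponent `0` has to be excluded: `U Uᵀ` is only the
projection onto the column space of `A`. -/
theorem adjMatrix_pow_eq (I : GraphInput.{u} N m) {p : ℕ} (hp : 1 ≤ p) :
    (I.G.adjMatrix ℝ) ^ p = I.U * Matrix.diagonal (fun l => I.Λ l ^ p) * I.Uᵀ := by
  induction p, hp using Nat.le_induction with
  | base => simpa using I.eig.eq
  | succ p hp ih =>
    rw [pow_succ, ih]
    conv_lhs => enter [2]; rw [I.eig.eq]
    calc I.U * Matrix.diagonal (fun l => I.Λ l ^ p) * I.Uᵀ *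
          (I.U * Matrix.diagonal I.Λ * I.Uᵀ)
        = I.U * (Matrix.diagonal (fun l => I.Λ l ^ p) * (I.Uᵀ * I.U) * Matrix.diagonal I.Λ) *
          I.Uᵀ := by simp only [Matrix.mul_assoc]
      _ = _ := by
        rw [I.eig.orthonormal, Matrix.mul_one, Matrix.diagonal_mul_diagonal]
        simp only [pow_succ]

/-- The integer matrix `M I` with real entries. -/
noncomputable def PairFeature.real (M : PairFeature.{u} N m) (I : GraphInput.{u} N m) :
    Matrix I.V I.V ℝ :=
  (M I).map (Int.cast : ℤ → ℝ)

/-- The link between network and combinatorics: the left side does not mention `U` and `Λ`, so inner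
products do not depend on the choice of eigenvectors. -/
theorem real_gram (M M' : PairFeature.{u} N m) (I : GraphInput.{u} N m) {p : ℕ} (hp : 1 ≤ p)
    (i j : I.V) : ((gram M p M' I i j : ℤ) : ℝ) =
      ∑ l, ((M.real I * I.U) i l * I.Λ l ^ p) * (M'.real I * I.U) j l := by
  have hA : ((adj I).map (Int.cast : ℤ → ℝ)) = I.G.adjMatrix ℝ := by
    ext a b
    simp only [adj, Matrix.map_apply, SimpleGraph.adjMatrix_apply]
    split_ifs <;> simp
  have h1 : (gram M p M' I).map (Int.cast : ℤ → ℝ) =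
      (M.real I * I.U) * Matrix.diagonal (fun l => I.Λ l ^ p) * (M'.real I * I.U)ᵀ := by
    have h2 : ((adj I) ^ p).map (Int.cast : ℤ → ℝ) = (I.G.adjMatrix ℝ) ^ p := by
      rw [← hA]
      exact map_pow (Int.castRingHom ℝ).mapMatrix (adj I) p
    have h3 : (gram M p M' I).map (Int.cast : ℤ → ℝ) =
        (M I).map (Int.cast : ℤ → ℝ) * ((adj I) ^ p).map (Int.cast : ℤ → ℝ) *
          ((M' I)ᵀ).map (Int.cast : ℤ → ℝ) := by
      let f := (Int.castRingHom ℝ).mapMatrix (m := I.V)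
      exact (map_mul f _ _).trans (congrArg (· * f (M' I)ᵀ) (map_mul f (M I) (adj I ^ p)))
    rw [h3, h2, adjMatrix_pow_eq I hp, Matrix.transpose_mul]
    simp only [PairFeature.real, Matrix.mul_assoc, Matrix.transpose_map]
  have h4 := congrFun (congrFun h1 i) j
  rw [Matrix.map_apply, Matrix.mul_apply] at h4
  simpa [Matrix.mul_diagonal] using h4

/-- The point representations `x` carry the node features `σ` as scalars, at the coordinates `cs`,
and the vectors `M U Λᵖ`, at the channels `cv`. -/
structure Carries (q : ℕ) (x : (I : GraphInput.{u} N m) → PointRep I.V I.r d)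
    (σ : α → NodeFeature.{u} N m) (M : κ → PairFeature.{u} N m) (cs : α → Fin d)
    (cv : κ × Fin (q + 1) → Fin d) : Prop where
  s : ∀ I i a, (x I).s i (cs a) = σ a I i
  v : ∀ I i l k p, (x I).v i l (cv (k, p)) = ((M k).real I * I.U) i l * I.Λ l ^ (p : ℕ)

/-- The `0`-`1` matrix whose row `c` selects the coordinate `f c`. -/
def selMatrix {ι κ : Type*} [DecidableEq ι] (f : κ → ι) : Matrix κ ι ℝ :=
  Matrix.of fun c a => if a = f c then 1 else 0

theorem selMatrix_mulVec {ι κ : Type*} [DecidableEq ι] [Fintype ι] (f : κ → ι) (x : ι → ℝ)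
    (c : κ) : (selMatrix f *ᵥ x) c = x (f c) := by
  simp [selMatrix, Matrix.mulVec, dotProduct]

theorem isMLP_sel {ι κ : Type} [DecidableEq ι] [Fintype ι] (f : κ → ι) :
    IsMLP (fun x : ι → ℝ => fun c => x (f c)) := by
  have := IsMLP.affine (selMatrix f) 0
  convert this using 2 with x
  funext c
  simp [selMatrix_mulVec]

theorem isMLP_sel_add {ι κ : Type} [DecidableEq ι] [Fintype ι] (f g : κ → ι) :
    IsMLP (fun x : ι → ℝ => fun c => x (f c) + x (g c)) := by
  have := IsMLP.affine (selMatrix f + selMatrix g) 0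
  convert this using 2 with x
  funext c
  simp [selMatrix_mulVec, Matrix.add_mulVec]

/-- With selection matrices on both sides, each diagonal entry is the inner product of two freely
chosen channels. -/
theorem diag_selMatrix {r : ℕ} (f g : Fin d → Fin d) (v w : Matrix (Fin r) (Fin d) ℝ)
    (c : Fin d) : Matrix.diag (selMatrix f * vᵀ * w * (selMatrix g)ᵀ) c =
      ∑ l, v l (f c) * w l (g c) := by
  have h1 : ∀ a, (selMatrix f * vᵀ) c a = v a (f c) := fun a => by
    simp [selMatrix, Matrix.mul_apply]
  simp only [Matrix.diag_apply, Matrix.mul_apply (M := selMatrix f * vᵀ * w)]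
  simp only [selMatrix, Matrix.transpose_apply, Matrix.of_apply, mul_ite, mul_one, mul_zero,
    Finset.sum_ite_eq', Finset.mem_univ, if_true]
  rw [Matrix.mul_apply]
  exact Finset.sum_congr rfl fun a _ => by rw [← h1 a]; rfl

/-- One vector carries the whole power `λ^(p+1)` and the other `λ^0`; `p.succ` avoids the exponent
`0`. -/
theorem Carries.inner {x : (I : GraphInput.{u} N m) → PointRep I.V I.r d}
    {σ : α → NodeFeature.{u} N m} {M : κ → PairFeature.{u} N m} {cs : α → Fin d}
    {cv : κ × Fin (q + 1) → Fin d} (h : Carries q x σ M cs cv) (I : GraphInput.{u} N m)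
    (i j : I.V) (k k' : κ) (p : Fin q) :
    ∑ l, (x I).v i l (cv (k, p.succ)) * (x I).v j l (cv (k', 0)) =
      gram (M k) (p + 1) (M k') I i j := by
  rw [real_gram _ _ _ (by omega)]
  refine Finset.sum_congr rfl fun l _ => ?_
  rw [h.v, h.v]
  simp

variable [Fintype α] [Fintype κ]

/-- A mixer computes determined node features. -/
theorem Carries.exists_mixer {x : (I : GraphInput.{u} N m) → PointRep I.V I.r d}
    {σ : α → NodeFeature.{u} N m} {M : κ → PairFeature.{u} N m} {cs : α → Fin d}
    {cv : κ × Fin (q + 1) → Fin d} (h : Carries q x σ M cs cv)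
    (hσ : ∀ a, NodeFeature.IsBounded (σ a)) (hM : ∀ k, PairFeature.IsBounded (M k))
    (hd : Fintype.card (κ × κ × Fin q) ≤ d) (φ : Fin d → NodeFeature.{u} N m)
    (hφ : ∀ c, NodeDetermined q (Set.range σ) (Set.range M) (φ c)) :
    ∃ (W₁ W₂ : Matrix (Fin d) (Fin d) ℝ) (F : (Fin d ⊕ Fin d → ℝ) → (Fin d → ℝ)), IsMLP F ∧
      ∀ I i, F (Sum.elim ((x I).s i) (Matrix.diag (W₁ * ((x I).v i)ᵀ * (x I).v i * W₂))) =
        fun c => (φ c I i : ℝ) := by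
  classical
  obtain ⟨e⟩ : Nonempty (κ × κ × Fin q ↪ Fin d) :=
    Function.Embedding.nonempty_of_card_le (by simpa using hd)
  obtain ⟨B, hB⟩ := exists_nodeKey_bound q hσ hM
  obtain ⟨F, hF, hF'⟩ := exists_isMLP_interpolation
    (Sum.map cs e : α ⊕ (κ × κ × Fin q) → Fin d ⊕ Fin d) B
    (fun z (c : Fin d) => ((Function.extend (nodeKey q σ M)
      (fun x : Σ I : GraphInput.{u} N m, I.V => φ c x.1 x.2) 0 z : ℤ) : ℝ))
  -- Each needed inner product gets its own diagonal entry through `e`. The entries outside the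
  -- range of `e` are arbitrary, and `F` does not depend on them.
  refine ⟨selMatrix (Function.extend e (fun t => cv (t.1, t.2.2.succ)) id),
    (selMatrix (Function.extend e (fun t => cv (t.2.1, 0)) id))ᵀ, F, hF, fun I i => ?_⟩
  rw [hF' _ (nodeKey q σ M ⟨I, i⟩) ?_ (hB _)]
  · funext c
    rw [(hφ c).factorsThrough.extend_apply]
  · rintro (a | t)
    · simp [nodeKey, h.s]
    · simp only [Sum.map_inr, Sum.elim_inr, diag_selMatrix, e.injective.extend_apply, nodeKey]
      exact h.inner I i i t.1 t.2.1 t.2.2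

/-- The attention matrices of a layer compute determined pair features. -/
theorem Carries.exists_attention {x : (I : GraphInput.{u} N m) → PointRep I.V I.r d}
    {σ : α → NodeFeature.{u} N m} {M : κ → PairFeature.{u} N m} {cs : α → Fin d}
    {cv : κ × Fin (q + 1) → Fin d} (h : Carries q x σ M cs cv)
    (hσ : ∀ a, NodeFeature.IsBounded (σ a)) (hM : ∀ k, PairFeature.IsBounded (M k))
    (hd : Fintype.card (κ × κ × Fin q) ≤ d) (hd' : Fintype.card (α × α) ≤ d)
    (F : Fin H → PairFeature.{u} N m)
    (hF : ∀ c, PairDetermined q (Set.range σ) (Set.range M) (F c)) :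
    ∃ (Wqs Wks Wqv Wkv : Matrix (Fin d) (Fin d) ℝ) (f : (Fin d ⊕ Fin d → ℝ) → (Fin H → ℝ)),
      IsMLP f ∧ ∀ I i j, f (Sum.elim ((Wqs *ᵥ (x I).s i) * (Wks *ᵥ (x I).s j))
        (Matrix.diag (Wqv * ((x I).v i)ᵀ * (x I).v j * Wkv))) = fun c => (F c I i j : ℝ) := by
  classical
  obtain ⟨e⟩ : Nonempty (κ × κ × Fin q ↪ Fin d) :=
    Function.Embedding.nonempty_of_card_le (by simpa using hd)
  obtain ⟨e'⟩ : Nonempty (α × α ↪ Fin d) :=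
    Function.Embedding.nonempty_of_card_le (by simpa using hd')
  obtain ⟨B, hB⟩ := exists_pairKey_bound q hσ hM
  obtain ⟨f, hf, hf'⟩ := exists_isMLP_interpolation
    (Sum.map e' e : (α × α) ⊕ (κ × κ × Fin q) → Fin d ⊕ Fin d) B
    (fun z (c : Fin H) => ((Function.extend (pairKey q σ M)
      (fun x : Σ I : GraphInput.{u} N m, I.V × I.V => F c x.1 x.2.1 x.2.2) 0 z : ℤ) : ℝ))
  refine ⟨selMatrix (Function.extend e' (fun t => cs t.1) id),
    selMatrix (Function.extend e' (fun t => cs t.2) id),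
    selMatrix (Function.extend e (fun t => cv (t.1, t.2.2.succ)) id),
    (selMatrix (Function.extend e (fun t => cv (t.2.1, 0)) id))ᵀ, f, hf, fun I i j => ?_⟩
  rw [hf' _ (pairKey q σ M ⟨I, i, j⟩) ?_ (hB _)]
  · funext c
    rw [(hF c).factorsThrough.extend_apply]
  · rintro (t | t)
    · simp [pairKey, h.s, selMatrix_mulVec, e'.injective.extend_apply]
    · simp only [Sum.map_inr, Sum.elim_inr, diag_selMatrix, e.injective.extend_apply, pairKey]
      exact h.inner I i j t.1 t.2.1 t.2.2

theorem NodeDetermined.isBounded {σ : α → NodeFeature.{u} N m} {M : κ → PairFeature.{u} N m}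
    {φ : NodeFeature.{u} N m} (h : NodeDetermined q (Set.range σ) (Set.range M) φ)
    (hσ : ∀ a, NodeFeature.IsBounded (σ a)) (hM : ∀ k, PairFeature.IsBounded (M k)) :
    φ.IsBounded := by
  obtain ⟨B, hB⟩ := exists_nodeKey_bound q hσ hM
  obtain ⟨C, hC⟩ := exists_bound_of_factorsThrough h.factorsThrough hB
  exact ⟨C, fun I i => hC ⟨I, i⟩⟩

/-- The update of a layer, for given outputs `y` of the mixer and attention matrices. -/
theorem exists_update {α' κ' : Type} [Fintype α'] [Fintype κ']
    (hα : Fintype.card α' ≤ d) (hκ : Fintype.card (κ' × Fin (q + 1)) ≤ d)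
    (y : (I : GraphInput.{u} N m) → PointRep I.V I.r d)
    (att : (I : GraphInput.{u} N m) → Fin H → Matrix I.V I.V ℝ)
    (σ' : α' → NodeFeature.{u} N m) (M' : κ' → PairFeature.{u} N m)
    (a₀ a₁ : α' → Fin d) (hs : α' → Fin H) (b₀ b₁ : κ' × Fin (q + 1) → Fin d)
    (hv : κ' → Fin H) (c : κ' → ℝ)
    (h₁ : ∀ a I i, (y I).s i (a₀ a) + ∑ j, att I (hs a) i j * (y I).s j (a₁ a) = σ' a I i)
    (h₂ : ∀ k p I i l, c k * (y I).v i l (b₀ (k, p)) +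
      ∑ j, att I (hv k) i j * (y I).v j l (b₁ (k, p)) =
        ((M' k).real I * I.U) i l * I.Λ l ^ (p : ℕ)) :
    ∃ (W₅ : Matrix (Fin d ⊕ Fin H × Fin d) (Fin d) ℝ)
      (F : (Fin d ⊕ Fin H × Fin d → ℝ) → (Fin d → ℝ)) (cs' : α' → Fin d)
      (cv' : κ' × Fin (q + 1) → Fin d), IsMLP F ∧ Function.Injective cv' ∧
      Carries q (fun I =>
        { s := fun i => F (Sum.elim ((y I).s i)
            (fun p => ∑ j, att I p.1 i j * (y I).s j p.2))
          v := fun i => Matrix.fromCols ((y I).v i)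
            (Matrix.of fun k p => ∑ j, att I p.1 i j * (y I).v j k p.2) * W₅ }) σ' M' cs' cv' := by
  classical
  obtain ⟨cs'⟩ : Nonempty (α' ↪ Fin d) :=
    Function.Embedding.nonempty_of_card_le (by simpa using hα)
  obtain ⟨cv'⟩ : Nonempty (κ' × Fin (q + 1) ↪ Fin d) :=
    Function.Embedding.nonempty_of_card_le (by simpa using hκ)
  let f₀ : Fin d → Fin d ⊕ Fin H × Fin d := Function.extend cs' (fun a => .inl (a₀ a)) .inl
  let f₁ : Fin d → Fin d ⊕ Fin H × Fin d :=
    Function.extend cs' (fun a => .inr (hs a, a₁ a)) .inl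
  let g₀ : Fin d → Fin d ⊕ Fin H × Fin d := Function.extend cv' (fun t => .inl (b₀ t)) .inl
  let g₁ : Fin d → Fin d ⊕ Fin H × Fin d :=
    Function.extend cv' (fun t => .inr (hv t.1, b₁ t)) .inl
  let w : Fin d → ℝ := Function.extend cv' (fun t => c t.1) 0
  refine ⟨Matrix.of fun z e => (if z = g₀ e then w e else 0) + (if z = g₁ e then 1 else 0),
    _, cs', cv', isMLP_sel_add f₀ f₁, cv'.injective, ⟨fun I i a => ?_, fun I i l k p => ?_⟩⟩
  · simp only [f₀, f₁, cs'.injective.extend_apply, Sum.elim_inl, Sum.elim_inr]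
    exact h₁ a I i
  · rw [← h₂]
    refine Matrix.mul_apply.trans ?_
    simp only [Matrix.of_apply, mul_add, mul_ite, mul_one, mul_zero, Finset.sum_add_distrib,
      Finset.sum_ite_eq', Finset.mem_univ, if_true, g₀, g₁, w, cv'.injective.extend_apply,
      Matrix.fromCols_apply_inl, Matrix.fromCols_apply_inr]
    rw [mul_comm]

/-- One layer computes the features of the next level. -/
theorem Carries.exists_layer {α' κ' : Type} [Fintype α'] [Fintype κ'] (ver : PSTVersion)
    {x : (I : GraphInput.{u} N m) → PointRep I.V I.r d}
    {σ : α → NodeFeature.{u} N m} {M : κ → PairFeature.{u} N m} {cs : α → Fin d}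
    {cv : κ × Fin (q + 1) → Fin d} (h : Carries q x σ M cs cv) (hcv : Function.Injective cv)
    (hσ : ∀ a, NodeFeature.IsBounded (σ a)) (hM : ∀ k, PairFeature.IsBounded (M k))
    (hH : Fintype.card (α' ⊕ κ') < H) (hκ : Fintype.card (κ × κ × Fin q) ≤ d)
    (hδ : Fintype.card (α ⊕ Unit ⊕ α' ⊕ α' ⊕ κ') *
      Fintype.card (α ⊕ Unit ⊕ α' ⊕ α' ⊕ κ') ≤ d)
    (hκ' : Fintype.card (κ' × Fin (q + 1)) ≤ d)
    {σ' φ₀ φ : α' → NodeFeature.{u} N m} {F : α' → PairFeature.{u} N m}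
    {M' G : κ' → PairFeature.{u} N m} {ψ : κ' → NodeFeature.{u} N m} {c : κ' → ℤ}
    {m₀ m₁ : κ' → κ} (hm₁ : Function.Injective m₁) (hm₀ : ∀ k k', m₁ k ≠ m₀ k')
    (hφ₀ : ∀ a, NodeDetermined q (Set.range σ) (Set.range M) (φ₀ a))
    (hφ : ∀ a, NodeDetermined q (Set.range σ) (Set.range M) (φ a))
    (hψ : ∀ k, NodeDetermined q (Set.range σ) (Set.range M) (ψ k))
    (hF : ∀ a, PairDetermined q (Set.range σ) (Set.range M) (F a))
    (hG : ∀ k, PairDetermined q (Set.range σ) (Set.range M) (G k))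
    (hσ' : ∀ a I i, σ' a I i = φ₀ a I i + ∑ j, F a I i j * φ a I j)
    (hM' : ∀ k I, M' k I = c k • M (m₀ k) I + G k I * Matrix.diagonal (ψ k I) * M (m₁ k) I) :
    ∃ (ℓ : PSTLayer d H) (cs' : α' → Fin d) (cv' : κ' × Fin (q + 1) → Fin d),
      Function.Injective cv' ∧ Carries q (fun I => ℓ.output ver (x I)) σ' M' cs' cv' := by
  classical
  -- The scalars after the mixer: the old ones, which the standard queries and keys still need, the
  -- constant `1`, and the new features `φ₀`, `φ`, `ψ`.
  let δ := α ⊕ Unit ⊕ α' ⊕ α' ⊕ κ'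
  let base : δ → NodeFeature.{u} N m :=
    Sum.elim σ (Sum.elim (fun _ _ _ => 1) (Sum.elim φ₀ (Sum.elim φ ψ)))
  have hδ1 : Fintype.card δ ≤ d := (Nat.le_mul_self _).trans hδ
  obtain ⟨e⟩ : Nonempty (δ ↪ Fin d) :=
    Function.Embedding.nonempty_of_card_le (by simpa using hδ1)
  obtain ⟨eh⟩ : Nonempty (α' ⊕ κ' ↪ Fin H) :=
    Function.Embedding.nonempty_of_card_le (by simpa using hH.le)
  have hbase : ∀ b, NodeDetermined q (Set.range σ) (Set.range M) (base b) := by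
    rintro (a | u | a | a | k)
    · exact fun I I' i i' h1 _ => h1 _ ⟨a, rfl⟩
    · exact fun _ _ _ _ _ _ => rfl
    exacts [hφ₀ a, hφ a, hψ k]
  let Φ : Fin d → NodeFeature.{u} N m := Function.extend e base (fun _ _ _ => 0)
  have hΦe : ∀ b, Φ (e b) = base b := fun b => e.injective.extend_apply _ _ _
  have hΦ : ∀ z, NodeDetermined q (Set.range σ) (Set.range M) (Φ z) := fun z => by
    by_cases hz : ∃ b, e b = z
    · obtain ⟨b, rfl⟩ := hz
      rw [hΦe]; exact hbase b
    · simp only [Φ, Function.extend_apply' _ _ _ hz]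
      exact fun _ _ _ _ _ _ => rfl
  obtain ⟨W₁, W₂, f₁, hf₁, hmix⟩ := h.exists_mixer hσ hM hκ Φ hΦ
  have hαd : Fintype.card α' ≤ d := by
    refine le_trans ?_ hδ1
    simp only [δ, Fintype.card_sum]
    omega
  -- What both versions have to deliver. The factor `ψ j` may come from the attention or from the
  -- gated vectors, since only their product enters.
  have key : ∀ (y : (I : GraphInput.{u} N m) → PointRep I.V I.r d)
      (att : (I : GraphInput.{u} N m) → Fin H → Matrix I.V I.V ℝ),
      (∀ I, (y I).s = fun i z => (Φ z I i : ℝ)) →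
      (∀ a I i j, att I (eh (.inl a)) i j = F a I i j) →
      (∀ k p I i l, (y I).v i l (cv (m₀ k, p)) = (x I).v i l (cv (m₀ k, p))) →
      (∀ k p I i j l, att I (eh (.inr k)) i j * (y I).v j l (cv (m₁ k, p)) =
        G k I i j * ψ k I j * (x I).v j l (cv (m₁ k, p))) →
      _ := fun y att hy hF hv₀ hv₁ =>
    exists_update hαd hκ' y att σ' M' (fun a => e (.inr (.inr (.inl a))))
      (fun a => e (.inr (.inr (.inr (.inl a))))) (fun a => eh (.inl a))
      (fun t => cv (m₀ t.1, t.2)) (fun t => cv (m₁ t.1, t.2)) (fun k => eh (.inr k))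
      (fun k => c k) (fun a I i => by
        simp only [hy, hF, hΦe, base, Sum.elim_inr, Sum.elim_inl, hσ']
        push_cast; rfl) (fun k p I i l => by
        simp only [hv₀, hv₁, h.v]
        have h1 : (M' k).real I = (c k : ℝ) • (M (m₀ k)).real I +
            (G k).real I * Matrix.diagonal (fun j => (ψ k I j : ℝ)) * (M (m₁ k)).real I := by
          ext a b
          simp only [PairFeature.real, hM', Matrix.map_apply, Matrix.add_apply,
            Matrix.smul_apply, smul_eq_mul]
          rw [Matrix.mul_apply, Matrix.mul_apply]
          simp only [Matrix.mul_diagonal, Matrix.map_apply]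
          push_cast; rfl
        rw [h1, Matrix.add_mul, Matrix.smul_mul, Matrix.add_apply, Matrix.smul_apply, smul_eq_mul,
          add_mul, Matrix.mul_assoc, mul_assoc]
        congr 1
        rw [Matrix.mul_apply, Finset.sum_mul]
        refine Finset.sum_congr rfl fun j _ => ?_
        rw [Matrix.mul_diagonal]
        simp only [PairFeature.real, Matrix.map_apply]
        ring)
  cases ver with
  | standard =>
    -- The gate cannot see `ψ`, so the vectors stay unchanged (`W₃ = 0`, `W₄ = 1`). Queries and keys
    -- come after the mixer, and the scalar product `1 * ψ j` puts the factor into the attention.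
    let y : (I : GraphInput.{u} N m) → PointRep I.V I.r d := fun I =>
      { s := fun i z => Φ z I i, v := (x I).v }
    have hy : Carries q y base M e cv := ⟨fun I i b => by simp only [y, hΦe], h.v⟩
    let A : Fin H → PairFeature.{u} N m := Function.extend eh
      (Sum.elim F (fun k I => Matrix.of fun i j => G k I i j * ψ k I j)) (fun _ _ => 0)
    have hsub : Set.range σ ⊆ Set.range base := by
      rintro _ ⟨a, rfl⟩; exact ⟨.inl a, rfl⟩
    have hA : ∀ z, PairDetermined q (Set.range base) (Set.range M) (A z) := fun z => by
      by_cases hz : ∃ b, eh b = z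
      · obtain ⟨a | k, rfl⟩ := hz
        · simpa only [A, eh.injective.extend_apply] using! (hF a).mono hsub subset_rfl
        · simp only [A, eh.injective.extend_apply]
          intro I I' i j i' j' h1 h2
          have h3 := (hG k).mono hsub subset_rfl I I' i j i' j' h1 h2
          have h4 := h1 _ ⟨.inr (.inl ()), rfl⟩ _ ⟨.inr (.inr (.inr (.inr k))), rfl⟩
          simp only [base, Sum.elim_inr, Sum.elim_inl, one_mul] at h4
          simp only [Sum.elim_inr, Matrix.of_apply, h3, h4]
      · simp only [A, Function.extend_apply' _ _ _ hz]
        exact fun _ _ _ _ _ _ _ _ => rfl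
    obtain ⟨Wqs, Wks, Wqv, Wkv, f₃, hf₃, hatt⟩ :=
      hy.exists_attention (fun b => (hbase b).isBounded hσ hM) hM hκ
        (by rw [Fintype.card_prod]; exact hδ) A hA
    obtain ⟨W₅, f₄, cs', cv', hf₄, hcv', hfin⟩ := key y (fun I z i j => A z I i j)
      (fun I => rfl) (fun a I i j => by simp [A, eh.injective.extend_apply])
      (fun _ _ _ _ _ => rfl)
      (fun k p I i j l => by simp [A, eh.injective.extend_apply, y])
    let ℓ : PSTLayer d H :=
      { W₁, W₂, W₃ := 0, W₄ := 1, Wqs, Wks, Wqv, Wkv, W₅, mlp₁ := f₁, mlp₂ := fun x c => x c,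
        mlp₃ := f₃, mlp₄ := f₄, isMLP₁ := hf₁, isMLP₂ := isMLP_sel (fun c => c),
        isMLP₃ := hf₃, isMLP₄ := hf₄ }
    refine ⟨ℓ, cs', cv', hcv', ?_⟩
    have h1 : ∀ I, ℓ.mixer .standard (x I) = y I := fun I => by
      simp only [PSTLayer.mixer, ℓ, y, hmix, Matrix.mul_zero, Matrix.mul_one, zero_add]
    have h2 : ∀ I z i j, ℓ.attention .standard (x I) z i j = A z I i j := fun I z i j => by
      simp only [PSTLayer.attention, h1, PSTLayer.scores, Matrix.of_apply]
      exact congrFun (hatt I i j) z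
    simp only [PSTLayer.output, h1, h2]
    exact hfin
  | weakened =>
    -- Here attention cannot see `ψ`, but the gate can: it multiplies the channels of `m₁` by `ψ`
    -- and all others by `1`. This requires the channels of `m₀` and `m₁` to be disjoint.
    let A : Fin H → PairFeature.{u} N m := Function.extend eh (Sum.elim F G) (fun _ _ => 0)
    have hA : ∀ z, PairDetermined q (Set.range σ) (Set.range M) (A z) := fun z => by
      by_cases hz : ∃ b, eh b = z
      · obtain ⟨a | k, rfl⟩ := hz
        · simpa only [A, eh.injective.extend_apply] using! hF a
        · simpa only [A, eh.injective.extend_apply] using! hG k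
      · simp only [A, Function.extend_apply' _ _ _ hz]
        exact fun _ _ _ _ _ _ _ _ => rfl
    obtain ⟨Wqs, Wks, Wqv, Wkv, f₃, hf₃, hatt⟩ :=
      h.exists_attention hσ hM hκ (by
        rw [Fintype.card_prod]
        refine le_trans (Nat.mul_self_le_mul_self ?_) hδ
        simp only [Fintype.card_sum]
        omega) A hA
    let gate : Fin d → Fin d := Function.extend (fun t : κ' × Fin (q + 1) => cv (m₁ t.1, t.2))
      (fun t => e (.inr (.inr (.inr (.inr t.1))))) (fun _ => e (.inr (.inl ())))
    have hinj : Function.Injective fun t : κ' × Fin (q + 1) => cv (m₁ t.1, t.2) :=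
      fun t t' ht => by
        have := Prod.mk.inj (hcv ht)
        exact Prod.ext (hm₁ this.1) this.2
    let y : (I : GraphInput.{u} N m) → PointRep I.V I.r d := fun I =>
      { s := fun i z => Φ z I i
        v := fun i => Matrix.of fun l z => (x I).v i l z * Φ (gate z) I i }
    obtain ⟨W₅, f₄, cs', cv', hf₄, hcv', hfin⟩ := key y (fun I z i j => A z I i j)
      (fun I => rfl) (fun a I i j => by simp [A, eh.injective.extend_apply])
      (fun k p I i l => by
        have : gate (cv (m₀ k, p)) = e (.inr (.inl ())) := Function.extend_apply' _ _ _ (by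
          rintro ⟨t, ht⟩
          exact hm₀ _ _ (Prod.mk.inj (hcv ht)).1)
        simp [y, this, hΦe, base])
      (fun k p I i j l => by
        have : gate (cv (m₁ k, p)) = e (.inr (.inr (.inr (.inr k)))) :=
          hinj.extend_apply _ _ (k, p)
        simp [A, eh.injective.extend_apply, y, this, hΦe, base]
        ring)
    let ℓ : PSTLayer d H :=
      { W₁, W₂, W₃ := 1, W₄ := 0, Wqs, Wks, Wqv, Wkv, W₅, mlp₁ := f₁,
        mlp₂ := fun x c => x (gate c),
        mlp₃ := f₃, mlp₄ := f₄, isMLP₁ := hf₁, isMLP₂ := isMLP_sel gate,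
        isMLP₃ := hf₃, isMLP₄ := hf₄ }
    refine ⟨ℓ, cs', cv', hcv', ?_⟩
    have h1 : ∀ I, ℓ.mixer .weakened (x I) = y I := fun I => by
      simp only [PSTLayer.mixer, ℓ, y, hmix, Matrix.mul_zero, Matrix.mul_one, add_zero]
      congr 1
      funext i
      ext l z
      simp [Matrix.mul_diagonal]
    have h2 : ∀ I z i j, ℓ.attention .weakened (x I) z i j = A z I i j := fun I z i j => by
      simp only [PSTLayer.attention, PSTLayer.scores, Matrix.of_apply]
      exact congrFun (hatt I i j) z
    simp only [PSTLayer.output, h1, h2]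
    exact hfin

/-- The initial point representations. -/
def initialRep (f : EigenvalueFunction d) (I : GraphInput.{u} N m) : PointRep I.V I.r d where
  s := fun i c => if hc : c.val < m then I.X i ⟨c.val, hc⟩ else 0
  v := psrd f I.U I.Λ

/-- The entrywise powers `λ ↦ λ ^ e c`. -/
def powerFunction (e : Fin d → ℕ) : EigenvalueFunction d where
  toFun := fun _ Λ k c => Λ k ^ e c
  equivariant := fun _ _ _ => rfl
  continuous := fun _ => by fun_prop

/-- Any finite family of features of level `k` is carried by the output of `k` layers. -/
theorem exists_front (ver : PSTVersion) (q k : ℕ) :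
    ∀ {α κ : Type} [Fintype α] [Fintype κ] (σ : α → NodeFeature.{u} N m)
      (M : κ → PairFeature.{u} N m), (∀ a, σ a ∈ (FeatureLevel.level q k).node) →
      (∀ a, M a ∈ (FeatureLevel.level q k).mat) →
      ∃ d₀ H₀ : ℕ, ∀ d ≥ d₀, ∀ H ≥ H₀, ∃ (f : EigenvalueFunction d)
        (front : List (PSTLayer d H)) (cs : α → Fin d) (cv : κ × Fin (q + 1) → Fin d),
        front.length = k ∧ Function.Injective cv ∧
        Carries q (fun I => front.foldl (fun x ℓ => ℓ.output ver x) (initialRep f I))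
          σ M cs cv := by
  -- All layers share one `d` and one `H`, so the induction provides every sufficiently large pair.
  induction k with
  | zero =>
    intro α κ _ _ σ M hσ hM
    refine ⟨Fintype.card (κ × Fin (q + 1)), 0, fun d hd H _ => ?_⟩
    obtain ⟨cv⟩ : Nonempty (κ × Fin (q + 1) ↪ Fin d) :=
      Function.Embedding.nonempty_of_card_le (by simpa using hd)
    -- The only matrix of level `0` is `1`, and its vectors `U Λᵖ` are initial coordinates for the
    -- eigenvalue function `λ ↦ λᵖ`.
    refine ⟨powerFunction (Function.extend cv (fun t => (t.2 : ℕ)) 0), [],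
      fun a => (hσ a).elim, cv, rfl, cv.injective, fun _ _ a => (hσ a).elim,
      fun I i l k p => ?_⟩
    have h1 : (M k).real I = 1 := by
      rw [Set.mem_singleton_iff.mp (hM k)]
      exact Matrix.map_one _ Int.cast_zero Int.cast_one
    simp [initialRep, psrd, powerFunction, cv.injective.extend_apply, h1]
  | succ k ih =>
    intro α' κ' _ _ σ' M' hσ' hM'
    choose φ₀ F φ hφ₀ hF hφ hσ'' using hσ'
    choose c M₀ M₁ G ψ hM₀ hM₁ hG hψ hM'' using hM'
    obtain ⟨a, b, σ, M, hσ, hM, h1, h2⟩ := FeatureLevel.Finitely.exists_families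
      (FeatureLevel.Finitely.and
        (fun S S' T T' hS hT (h : ∀ a, (NodeDetermined q S T (φ₀ a) ∧
          NodeDetermined q S T (φ a)) ∧ PairDetermined q S T (F a)) a =>
          ⟨⟨(h a).1.1.mono hS hT, (h a).1.2.mono hS hT⟩, (h a).2.mono hS hT⟩)
        (fun S S' T T' hS hT (h : ∀ k, PairDetermined q S T (G k) ∧
          NodeDetermined q S T (ψ k)) k => ⟨(h k).1.mono hS hT, (h k).2.mono hS hT⟩)
        (FeatureLevel.Finitely.forall
          (fun a S S' T T' hS hT h =>
            ⟨⟨h.1.1.mono hS hT, h.1.2.mono hS hT⟩, h.2.mono hS hT⟩)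
          fun a => FeatureLevel.Finitely.and
            (fun S S' T T' hS hT h => ⟨h.1.mono hS hT, h.2.mono hS hT⟩)
            (fun S S' T T' hS hT h => h.mono hS hT) ((hφ₀ a).and (hφ a)) (hF a))
        (FeatureLevel.Finitely.forall
          (fun a S S' T T' hS hT h => ⟨h.1.mono hS hT, h.2.mono hS hT⟩)
          fun k => (hG k).and_isNode (hψ k)))
    -- Matrices may be listed repeatedly: each use as `M₀` or `M₁` gets separate channels, so that
    -- gating one does not disturb another.
    let Ms : Fin b ⊕ κ' ⊕ κ' → PairFeature.{u} N m := Sum.elim M (Sum.elim M₀ M₁)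
    have hMs : ∀ t, Ms t ∈ (FeatureLevel.level q k).mat := by
      rintro (t | t | t)
      exacts [hM t, hM₀ t, hM₁ t]
    have hsub : Set.range M ⊆ Set.range Ms := by
      rintro _ ⟨t, rfl⟩; exact ⟨.inl t, rfl⟩
    obtain ⟨d₀, H₀, hfront⟩ := ih σ Ms hσ hMs
    refine ⟨d₀ + Fintype.card ((Fin b ⊕ κ' ⊕ κ') × (Fin b ⊕ κ' ⊕ κ') × Fin q) +
      Fintype.card (Fin a ⊕ Unit ⊕ α' ⊕ α' ⊕ κ') * Fintype.card (Fin a ⊕ Unit ⊕ α' ⊕ α' ⊕ κ') +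
      Fintype.card (κ' × Fin (q + 1)), H₀ + Fintype.card (α' ⊕ κ') + 1, fun d hd H hH => ?_⟩
    obtain ⟨f, front, cs, cv, hlen, hcv, hcarry⟩ := hfront d (by omega) H (by omega)
    have hb := FeatureLevel.bounded_level (N := N) (m := m) (q := q) k
    obtain ⟨ℓ, cs', cv', hcv', h'⟩ := hcarry.exists_layer (H := H) ver hcv
      (fun t => hb.node _ (hσ t))
      (fun t => hb.mat _ (hMs t)) (σ' := σ') (φ₀ := φ₀) (φ := φ) (F := F) (M' := M') (G := G)
      (ψ := ψ) (c := c) (m₀ := fun t => .inr (.inl t)) (m₁ := fun t => .inr (.inr t))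
      (by omega) (by omega) (by omega) (by omega) 
      (fun s t hst => Sum.inr_injective (Sum.inr_injective hst))
      (fun s t => by simp)
      (fun t => (h1 t).1.1.mono subset_rfl hsub)
      (fun t => (h1 t).1.2.mono subset_rfl hsub) (fun t => (h2 t).2.mono subset_rfl hsub)
      (fun t => (h1 t).2.mono subset_rfl hsub) (fun t => (h2 t).1.mono subset_rfl hsub)
      hσ'' hM''
    refine ⟨f, front ++ [ℓ], cs', cv', by simp [hlen], hcv', ?_⟩
    simpa only [List.foldl_append, List.foldl_cons, List.foldl_nil] using h'

/-- A pair feature of level `k` is an attention matrix of the last of `k + 1` layers. -/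
theorem canCountPaths_of_isPair (ver : PSTVersion) (q k L : ℕ)
    (h : ∀ N m : ℕ, ∃ F : PairFeature.{u} N m, (FeatureLevel.level q k).IsPair q F ∧
      ∀ I i j, i ≠ j → F I i j = pathCount I.G L i j) :
    CanCountPaths.{u} ver (k + 1) L := by
  intro N m
  obtain ⟨F, hF, hcount⟩ := h N m
  obtain ⟨a, b, σ, M, hσ, hM, hdet⟩ := FeatureLevel.Finitely.exists_families hF
  obtain ⟨d₀, H₀, hfront⟩ := exists_front ver q k σ M hσ hM
  let d := d₀ + m + Fintype.card (Fin b × Fin b × Fin q) + Fintype.card (Fin a × Fin a)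
  obtain ⟨f, front, cs, cv, hlen, hcv, hcarry⟩ := hfront d (by omega) (H₀ + 1) (by omega)
  have hb := FeatureLevel.bounded_level (N := N) (m := m) (q := q) k
  obtain ⟨Wqs, Wks, Wqv, Wkv, f₃, hf₃, hatt⟩ := hcarry.exists_attention
    (fun t => hb.node _ (hσ t)) (fun t => hb.mat _ (hM t)) (by omega) (by omega)
    (fun _ : Fin (H₀ + 1) => F) fun _ => hdet
  -- In the standard version this mixer is the identity; in the weakened one the attention bypasses
  -- it. Either way the scores are those of the carried features.
  let ℓ : PSTLayer d (H₀ + 1) :=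
    { W₁ := 0, W₂ := 0, W₃ := 0, W₄ := 1, Wqs, Wks, Wqv, Wkv, W₅ := 0,
      mlp₁ := fun x c => x (.inl c), mlp₂ := fun x c => x c, mlp₃ := f₃,
      mlp₄ := fun x c => x (.inl c), isMLP₁ := isMLP_sel Sum.inl,
      isMLP₂ := isMLP_sel (fun c => c), isMLP₃ := hf₃, isMLP₄ := isMLP_sel Sum.inl }
  have hmix : ∀ {V : Type u} {r : ℕ} (x : PointRep V r d), ℓ.mixer .standard x = x :=
    fun x => by
      simp only [PSTLayer.mixer, ℓ, Matrix.mul_zero, Matrix.mul_one, zero_add, Sum.elim_inl]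
  refine ⟨d, H₀ + 1, ⟨f, front, ℓ⟩, by omega, by omega, by simp [PST.depth, hlen], ?_⟩
  intro V _ G _ hV X r U Λ hU h i j hij
  let I : GraphInput.{u} N m :=
    { V, decEq := Classical.decEq V, G, card_le := hV, X, r, U, Λ, eig := hU }
  have h1 : ∀ x : PointRep V r d, ℓ.attention ver x h i j = ℓ.scores x h i j := fun x => by
    cases ver with
    | standard => simp only [PSTLayer.attention, hmix]
    | weakened => rfl
  have h2 := congrFun (hatt I i j) h
  have h3 := hcount I i j hij
  rw [PST.lastAttention, h1]
  refine Eq.trans h2 ?_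
  rw [h3]
  rfl

end Network

/-! ### Sums over distinct vertices -/

section DistinctSums

variable {V R : Type*} [Fintype V] [DecidableEq V] [CommRing R]

/-- Sum over a vertex outside of `s`. -/
def dsum₁ (s : Finset V) (g : V → R) : R := ∑ x ∈ sᶜ, g x

/-- Sum over two distinct vertices outside of `s`. -/
def dsum₂ (s : Finset V) (g : V → V → R) : R := dsum₁ s fun x => dsum₁ (insert x s) (g x)

/-- Sum over three distinct vertices outside of `s`. -/
def dsum₃ (s : Finset V) (g : V → V → V → R) : R := dsum₁ s fun x => dsum₂ (insert x s) (g x)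

/-- Sum over four distinct vertices outside of `s`. -/
def dsum₄ (s : Finset V) (g : V → V → V → V → R) : R :=
  dsum₁ s fun x => dsum₃ (insert x s) (g x)

/-- Sum over five distinct vertices outside of `s`. -/
def dsum₅ (s : Finset V) (g : V → V → V → V → V → R) : R :=
  dsum₁ s fun x => dsum₄ (insert x s) (g x)

variable {s : Finset V}

theorem dsum₁_congr {g g' : V → R} (h : ∀ x, x ∉ s → g x = g' x) : dsum₁ s g = dsum₁ s g' :=
  Finset.sum_congr rfl fun x hx => h x (Finset.mem_compl.mp hx)

theorem dsum₂_congr {g g' : V → V → R} (h : ∀ x y, x ∉ s → y ∉ insert x s → g x y = g' x y) :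
    dsum₂ s g = dsum₂ s g' :=
  dsum₁_congr fun x hx => dsum₁_congr fun y hy => h x y hx hy

theorem dsum₁_add (g g' : V → R) : dsum₁ s (fun x => g x + g' x) = dsum₁ s g + dsum₁ s g' :=
  Finset.sum_add_distrib

theorem dsum₁_sub (g g' : V → R) : dsum₁ s (fun x => g x - g' x) = dsum₁ s g - dsum₁ s g' :=
  Finset.sum_sub_distrib _ _

theorem dsum₁_mul_left (c : R) (g : V → R) : dsum₁ s (fun x => c * g x) = c * dsum₁ s g :=
  (Finset.mul_sum _ _ _).symm

theorem dsum₂_add (g g' : V → V → R) :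
    dsum₂ s (fun x y => g x y + g' x y) = dsum₂ s g + dsum₂ s g' := by
  simp only [dsum₂, dsum₁_add]

theorem dsum₂_sub (g g' : V → V → R) :
    dsum₂ s (fun x y => g x y - g' x y) = dsum₂ s g - dsum₂ s g' := by
  simp only [dsum₂, dsum₁_sub]

theorem dsum₂_mul_left (c : R) (g : V → V → R) :
    dsum₂ s (fun x y => c * g x y) = c * dsum₂ s g := by
  simp only [dsum₂, dsum₁_mul_left]

/-- Letting `h` depend on the set of used vertices allows further nested sums inside, so one
exchange yields all adjacent transpositions. -/
theorem dsum₁_swap (s : Finset V) (h : V → V → Finset V → R) :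
    dsum₁ s (fun x => dsum₁ (insert x s) fun y => h x y (insert y (insert x s))) =
      dsum₁ s (fun y => dsum₁ (insert y s) fun x => h x y (insert x (insert y s))) := by
  simp only [dsum₁]
  rw [Finset.sum_comm' (t' := sᶜ) (s' := fun y => (insert y s)ᶜ)]
  · simp only [Finset.insert_comm]
  · intro x y
    simp only [Finset.mem_compl, Finset.mem_insert, not_or]
    tauto

theorem dsum₂_swap (g : V → V → R) : dsum₂ s g = dsum₂ s fun x y => g y x :=
  dsum₁_swap s fun x y _ => g x y

theorem dsum₃_swap₁₂ (g : V → V → V → R) : dsum₃ s g = dsum₃ s fun x y z => g y x z :=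
  dsum₁_swap s fun x y t => dsum₁ t (g x y)

theorem dsum₃_swap₂₃ (g : V → V → V → R) : dsum₃ s g = dsum₃ s fun x y z => g x z y :=
  dsum₁_congr fun x _ => dsum₂_swap (g x)

theorem dsum₄_swap₁₂ (g : V → V → V → V → R) : dsum₄ s g = dsum₄ s fun x y z w => g y x z w :=
  dsum₁_swap s fun x y t => dsum₂ t (g x y)

theorem dsum₄_swap₂₃ (g : V → V → V → V → R) : dsum₄ s g = dsum₄ s fun x y z w => g x z y w :=
  dsum₁_congr fun x _ => dsum₃_swap₁₂ (g x)

theorem dsum₄_swap₃₄ (g : V → V → V → V → R) : dsum₄ s g = dsum₄ s fun x y z w => g x y w z :=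
  dsum₁_congr fun x _ => dsum₃_swap₂₃ (g x)

theorem dsum₅_swap₃₄ (g : V → V → V → V → V → R) :
    dsum₅ s g = dsum₅ s fun x y z w v => g x y w z v :=
  dsum₁_congr fun x _ => dsum₄_swap₂₃ (g x)

theorem dsum₅_swap₄₅ (g : V → V → V → V → V → R) :
    dsum₅ s g = dsum₅ s fun x y z w v => g x y z v w :=
  dsum₁_congr fun x _ => dsum₄_swap₃₄ (g x)

theorem dsum₄_reverse (g : V → V → V → V → R) : dsum₄ s g = dsum₄ s fun x y z w => g w z y x := by
  rw [dsum₄_swap₁₂, dsum₄_swap₂₃, dsum₄_swap₃₄, dsum₄_swap₁₂, dsum₄_swap₂₃, dsum₄_swap₁₂]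

theorem dsum₃_congr {g g' : V → V → V → R}
    (h : ∀ x y z, x ∉ s → y ∉ insert x s → z ∉ insert y (insert x s) → g x y z = g' x y z) :
    dsum₃ s g = dsum₃ s g' :=
  dsum₁_congr fun x hx => dsum₂_congr fun y z hy hz => h x y z hx hy hz

theorem dsum₄_congr {g g' : V → V → V → V → R}
    (h : ∀ x y z w, x ∉ s → y ∉ insert x s → z ∉ insert y (insert x s) →
      w ∉ insert z (insert y (insert x s)) → g x y z w = g' x y z w) :
    dsum₄ s g = dsum₄ s g' :=
  dsum₁_congr fun x hx => dsum₃_congr fun y z w hy hz hw => h x y z w hx hy hz hw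

theorem dsum₄_sub (g g' : V → V → V → V → R) :
    dsum₄ s (fun x y z w => g x y z w - g' x y z w) = dsum₄ s g - dsum₄ s g' := by
  simp only [dsum₄, dsum₃, dsum₂, dsum₁_sub]

theorem dsum₁_eq_sub (s : Finset V) (g : V → R) : dsum₁ s g = ∑ x, g x - ∑ x ∈ s, g x := by
  rw [dsum₁, ← Finset.sum_compl_add_sum s g, add_sub_cancel_right]

theorem dsum₁_insert {x : V} (hx : x ∉ s) (g : V → R) :
    dsum₁ (insert x s) g = dsum₁ s g - g x := by
  rw [dsum₁_eq_sub, dsum₁_eq_sub, Finset.sum_insert hx]; ring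

theorem dsum₁_pair {i j : V} (hij : i ≠ j) (g : V → R) :
    dsum₁ {i, j} g = ∑ x, g x - g i - g j := by
  rw [dsum₁_eq_sub, Finset.sum_pair hij]; ring

/-- Independent sums minus the diagonal `x = y`. -/
theorem dsum₂_mul (u v : V → R) : dsum₂ s (fun x y => u x * v y) =
    dsum₁ s u * dsum₁ s v - dsum₁ s fun x => u x * v x := by
  have : dsum₁ s u * dsum₁ s v = dsum₁ s fun x => u x * dsum₁ s v := Finset.sum_mul _ _ _
  rw [this, ← dsum₁_sub]
  refine dsum₁_congr fun x hx => ?_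
  rw [dsum₁_mul_left, dsum₁_insert hx]; ring

/-- Sum over the second vertex first. -/
theorem dsum₂_eq_left {i j : V} (hij : i ≠ j) (f : V → R) (h : V → V → R) :
    dsum₂ {i, j} (fun b c => f b * h b c) =
      dsum₁ {i, j} fun b => f b * (∑ c, h b c - h b b - h b i - h b j) :=
  dsum₁_congr fun b hb => by
    rw [dsum₁_mul_left, dsum₁_insert hb, dsum₁_pair hij]; ring

/-- Sum over the first vertex first. -/
theorem dsum₂_eq_right {i j : V} (hij : i ≠ j) (f : V → R) (h : V → V → R) :
    dsum₂ {i, j} (fun b c => f c * h b c) =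
      dsum₁ {i, j} fun c => f c * (∑ b, h b c - h c c - h i c - h j c) := by
  rw [dsum₂_swap, dsum₂_eq_left hij f fun c b => h b c]

end DistinctSums

/-! ### Path counts as sums over distinct vertices -/

section PathCount

variable {V : Type*} [Fintype V] [DecidableEq V] (G : SimpleGraph V) [DecidableRel G.Adj]

/-- The number of paths of length `L` from `i` to `j` that meet `s` at most in `i`. -/
noncomputable def avoidCount (L : ℕ) (s : Finset V) (i j : V) : ℕ :=
  Nat.card {p : G.Walk i j // (p.IsPath ∧ p.length = L) ∧ ∀ v ∈ p.support.tail, v ∉ s}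

theorem finite_walks (L : ℕ) (i j : V) (P : G.Walk i j → Prop) (hP : ∀ p, P p → p.length = L) :
    Finite {p : G.Walk i j // P p} :=
  Set.Finite.subset (Set.toFinite {p : G.Walk i j | p.length = L}) hP

/-- Split off the first edge. Since `i ∈ s`, the remainder never returns to `i`, so prepending `i`
keeps it a path; inserting `a` into `s` records that the remainder does not revisit `a`. -/
theorem avoidCount_succ (L : ℕ) (s : Finset V) (i j : V) (hi : i ∈ s) :
    (avoidCount G (L + 1) s i j : ℤ) =
      ∑ a ∈ sᶜ, G.adjMatrix ℤ i a * avoidCount G L (insert a s) a j := by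
  let β : {a // a ∈ sᶜ ∧ G.Adj i a} → Type _ := fun a =>
    {p : G.Walk a j // (p.IsPath ∧ p.length = L) ∧ ∀ v ∈ p.support.tail, v ∉ insert a.1 s}
  have hfin : ∀ a, Finite (β a) := fun a => finite_walks G L _ _ _ fun p hp => hp.1.2
  let f : (Σ a, β a) → {p : G.Walk i j // (p.IsPath ∧ p.length = L + 1) ∧
      ∀ v ∈ p.support.tail, v ∉ s} := fun x =>
    ⟨SimpleGraph.Walk.cons x.1.2.2 x.2.1, by
      obtain ⟨⟨a, ha, hadj⟩, p, ⟨hp, hlen⟩, hs⟩ := x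
      have hs' : ∀ v ∈ p.support, v ∉ s := fun v hv => by
        rw [← p.cons_tail_support] at hv
        rcases List.mem_cons.mp hv with rfl | hv
        · exact Finset.mem_compl.mp ha
        · exact fun h => hs v hv (Finset.mem_insert_of_mem h)
      refine ⟨⟨?_, by simp [hlen]⟩, by simpa using hs'⟩
      rw [SimpleGraph.Walk.cons_isPath_iff]
      exact ⟨hp, fun h => hs' i h hi⟩⟩
  have hf : Function.Bijective f := by
    constructor
    · rintro ⟨⟨a, ha⟩, p, hp⟩ ⟨⟨b, hb⟩, r, hr⟩ h
      have h1 := congrArg Subtype.val h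
      simp only [f, SimpleGraph.Walk.cons.injEq] at h1
      obtain ⟨rfl, h2⟩ := h1
      obtain rfl := eq_of_heq h2
      rfl
    · rintro ⟨p, ⟨hp, hlen⟩, hs⟩
      cases p with
      | nil => simp at hlen
      | @cons _ a _ hadj p =>
        rw [SimpleGraph.Walk.cons_isPath_iff] at hp
        simp only [SimpleGraph.Walk.support_cons, List.tail_cons] at hs
        refine ⟨⟨⟨a, Finset.mem_compl.mpr (hs a p.start_mem_support), hadj⟩, p,
          ⟨hp.1, by simpa using hlen⟩, fun v hv => ?_⟩, rfl⟩
        have hnd := hp.1.support_nodup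
        rw [← p.cons_tail_support] at hnd
        rw [Finset.mem_insert]
        rintro (rfl | h)
        · exact (List.nodup_cons.mp hnd).1 hv
        · exact hs v (List.mem_of_mem_tail hv) h
  rw [avoidCount, ← Nat.card_congr (Equiv.ofBijective f hf), Nat.card_sigma]
  simp only [SimpleGraph.adjMatrix_apply, ite_mul, one_mul, zero_mul]
  rw [← Finset.sum_filter, Nat.cast_sum]
  exact Finset.sum_subtype (p := fun a => a ∈ sᶜ ∧ G.Adj i a) _ (by simp)
    (fun a => (avoidCount G L (insert a s) a j : ℤ)) |>.symm

theorem avoidCount_zero_self (s : Finset V) (j : V) : avoidCount G 0 s j j = 1 := by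
  rw [avoidCount, Nat.card_eq_one_iff_unique]
  refine ⟨⟨fun p q => Subtype.ext ?_⟩, ⟨⟨.nil, by simp⟩⟩⟩
  rw [(SimpleGraph.Walk.length_eq_zero_iff.mp p.2.1.2).eq_nil,
    (SimpleGraph.Walk.length_eq_zero_iff.mp q.2.1.2).eq_nil]

theorem avoidCount_zero_of_ne (s : Finset V) {i j : V} (hij : i ≠ j) :
    avoidCount G 0 s i j = 0 := by
  have : IsEmpty {p : G.Walk i j // (p.IsPath ∧ p.length = 0) ∧ ∀ v ∈ p.support.tail, v ∉ s} :=
    ⟨fun p => hij (SimpleGraph.Walk.eq_of_length_eq_zero p.2.1.2)⟩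
  exact Nat.card_of_isEmpty

theorem avoidCount_succ_self (L : ℕ) (s : Finset V) (j : V) : avoidCount G (L + 1) s j j = 0 := by
  have : IsEmpty {p : G.Walk j j // (p.IsPath ∧ p.length = L + 1) ∧
      ∀ v ∈ p.support.tail, v ∉ s} := ⟨fun p => by
    have h1 := SimpleGraph.Walk.length_eq_zero_iff.mpr
      (SimpleGraph.Walk.isPath_iff_nil.mp p.2.1.1)
    have h2 := p.2.1.2
    omega⟩
  exact Nat.card_of_isEmpty

theorem avoidCount_one {s : Finset V} {i j : V} (hi : i ∈ s) (hj : j ∉ s) :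
    (avoidCount G 1 s i j : ℤ) = G.adjMatrix ℤ i j := by
  rw [avoidCount_succ G 0 s i j hi, Finset.sum_eq_single j]
  · simp [avoidCount_zero_self]
  · intro a _ ha
    simp [avoidCount_zero_of_ne G _ ha]
  · intro h
    exact absurd (Finset.mem_compl.mpr hj) h

/-- The path must reach `j`, while the sum should exclude `j`. With at least one edge left after the
first step, the term `a = j` is zero, so both conventions agree. -/
theorem avoidCount_erase_add_two {t : Finset V} {i j : V} (L : ℕ) (hi : i ∈ t) (hj : j ∈ t)
    (hij : i ≠ j) : (avoidCount G (L + 2) (t.erase j) i j : ℤ) =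
      dsum₁ t fun a => G.adjMatrix ℤ i a * avoidCount G (L + 1) ((insert a t).erase j) a j := by
  rw [avoidCount_succ G (L + 1) _ i j (Finset.mem_erase.mpr ⟨hij, hi⟩)]
  have h := dsum₁_insert (Finset.notMem_erase j t)
    fun a => G.adjMatrix ℤ i a * (avoidCount G (L + 1) (insert a (t.erase j)) a j : ℤ)
  rw [Finset.insert_erase hj, avoidCount_succ_self, Nat.cast_zero, mul_zero, sub_zero] at h
  refine h.symm.trans (dsum₁_congr fun a ha => ?_)
  rw [Finset.erase_insert_of_ne (fun h : a = j => ha (h ▸ hj))]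

theorem pathCount_eq_avoidCount {V : Type*} [DecidableEq V] (G : SimpleGraph V) (L : ℕ)
    {i j : V} (hij : i ≠ j) :
    pathCount G L i j = avoidCount G L (Finset.erase {i, j} j) i j := by
  refine Nat.card_congr
    ⟨fun p => ⟨p.1.1, ⟨p.1.2, p.2⟩, fun v hv => ?_⟩, fun p => ⟨⟨p.1, p.2.1.1⟩, p.2.1.2⟩,
      fun _ => rfl, fun _ => rfl⟩
  have hnd := p.1.2.support_nodup
  rw [← p.1.1.cons_tail_support] at hnd
  have : Finset.erase {i, j} j = {i} := by
    ext x; simp only [Finset.mem_erase, Finset.mem_insert, Finset.mem_singleton]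
    constructor
    · rintro ⟨h1, h2 | h2⟩
      exacts [h2, absurd h2 h1]
    · rintro rfl; exact ⟨hij, .inl rfl⟩
  rw [this, Finset.mem_singleton]
  rintro rfl
  exact (List.nodup_cons.mp hnd).1 hv

theorem pathCount_one {i j : V} (hij : i ≠ j) : (pathCount G 1 i j : ℤ) = G.adjMatrix ℤ i j := by
  rw [pathCount_eq_avoidCount G 1 hij]
  exact avoidCount_one G (by simp [hij]) (by simp)

/-- The paths of length one from `x` to `j` that avoid `t` except at `j`. -/
theorem avoidCount_erase_one {t : Finset V} {x j : V} (hx : x ∈ t) (hxj : x ≠ j) :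
    (avoidCount G 1 (t.erase j) x j : ℤ) = G.adjMatrix ℤ x j :=
  avoidCount_one G (Finset.mem_erase.mpr ⟨hxj, hx⟩) (Finset.notMem_erase j t)

theorem avoidCount_erase_two {t : Finset V} {x j : V} (hx : x ∈ t) (hj : j ∈ t) (hxj : x ≠ j) :
    (avoidCount G 2 (t.erase j) x j : ℤ) =
      dsum₁ t fun a => G.adjMatrix ℤ x a * G.adjMatrix ℤ a j := by
  rw [avoidCount_erase_add_two G 0 hx hj hxj]
  exact dsum₁_congr fun a ha => by
    rw [avoidCount_erase_one G (Finset.mem_insert_self a t) (fun h => ha (h ▸ hj))]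

theorem avoidCount_erase_three {t : Finset V} {x j : V} (hx : x ∈ t) (hj : j ∈ t) (hxj : x ≠ j) :
    (avoidCount G 3 (t.erase j) x j : ℤ) = dsum₂ t fun a b =>
      G.adjMatrix ℤ x a * (G.adjMatrix ℤ a b * G.adjMatrix ℤ b j) := by
  rw [avoidCount_erase_add_two G 1 hx hj hxj]
  exact dsum₁_congr fun a ha => by
    rw [avoidCount_erase_two G (Finset.mem_insert_self a t) (Finset.mem_insert_of_mem hj)
      (fun h => ha (h ▸ hj)), ← dsum₁_mul_left]

theorem avoidCount_erase_four {t : Finset V} {x j : V} (hx : x ∈ t) (hj : j ∈ t) (hxj : x ≠ j) :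
    (avoidCount G 4 (t.erase j) x j : ℤ) = dsum₃ t fun a b c =>
      G.adjMatrix ℤ x a * (G.adjMatrix ℤ a b * (G.adjMatrix ℤ b c * G.adjMatrix ℤ c j)) := by
  rw [avoidCount_erase_add_two G 2 hx hj hxj]
  exact dsum₁_congr fun a ha => by
    rw [avoidCount_erase_three G (Finset.mem_insert_self a t) (Finset.mem_insert_of_mem hj)
      (fun h => ha (h ▸ hj)), ← dsum₂_mul_left]

theorem avoidCount_erase_five {t : Finset V} {x j : V} (hx : x ∈ t) (hj : j ∈ t) (hxj : x ≠ j) :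
    (avoidCount G 5 (t.erase j) x j : ℤ) = dsum₄ t fun a b c d =>
      G.adjMatrix ℤ x a * (G.adjMatrix ℤ a b * (G.adjMatrix ℤ b c * (G.adjMatrix ℤ c d *
        G.adjMatrix ℤ d j))) := by
  rw [avoidCount_erase_add_two G 3 hx hj hxj]
  refine dsum₁_congr fun a ha => ?_
  rw [avoidCount_erase_four G (Finset.mem_insert_self a t) (Finset.mem_insert_of_mem hj)
    (fun h => ha (h ▸ hj))]
  simp only [dsum₃, dsum₂, ← dsum₁_mul_left]

theorem avoidCount_erase_six {t : Finset V} {x j : V} (hx : x ∈ t) (hj : j ∈ t) (hxj : x ≠ j) :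
    (avoidCount G 6 (t.erase j) x j : ℤ) = dsum₅ t fun a b c d e =>
      G.adjMatrix ℤ x a * (G.adjMatrix ℤ a b * (G.adjMatrix ℤ b c * (G.adjMatrix ℤ c d *
        (G.adjMatrix ℤ d e * G.adjMatrix ℤ e j)))) := by
  rw [avoidCount_erase_add_two G 4 hx hj hxj]
  refine dsum₁_congr fun a ha => ?_
  rw [avoidCount_erase_five G (Finset.mem_insert_self a t) (Finset.mem_insert_of_mem hj)
    (fun h => ha (h ▸ hj))]
  simp only [dsum₄, dsum₃, dsum₂, ← dsum₁_mul_left]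

end PathCount

/-! ### Eliminating inner vertices -/

section Elimination

variable {V : Type*} [Fintype V] [DecidableEq V] {A : Matrix V V ℤ}

theorem Matrix.IsAdjMatrix.comm (hA : A.IsAdjMatrix) (x y : V) : A y x = A x y :=
  hA.symm.apply x y

theorem Matrix.IsAdjMatrix.sq (hA : A.IsAdjMatrix) (x y : V) : A x y * A x y = A x y := by
  rcases hA.zero_or_one x y with h | h <;> simp [h]

theorem Matrix.IsAdjMatrix.sum_mul (hA : A.IsAdjMatrix) (x y : V) :
    ∑ z, A x z * A y z = (A ^ 2) x y := by
  rw [pow_two, Matrix.mul_apply]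
  exact Finset.sum_congr rfl fun z _ => by rw [hA.comm z y]

/-- Elimination of a vertex with the neighbors `x` and `y`. -/
theorem Matrix.IsAdjMatrix.dsum_mul (_hA : A.IsAdjMatrix) (s : Finset V) (x y : V) :
    dsum₁ s (fun z => A x z * A z y) = (A ^ 2) x y - ∑ z ∈ s, A x z * A z y := by
  rw [dsum₁_eq_sub, pow_two, Matrix.mul_apply]

variable {i j : V}

/-- Excluding `a` and `e` costs nothing because the diagonal vanishes; only `i` and `j` need
corrections. -/
theorem Matrix.IsAdjMatrix.dsum₁_mul_insert₂ (hA : A.IsAdjMatrix) {a e : V}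
    (ha : a ∉ ({i, j} : Finset V))
    (he : e ∉ insert a ({i, j} : Finset V)) (hij : i ≠ j) :
    dsum₁ (insert e (insert a {i, j})) (fun z => A a z * A z e) =
      (A ^ 2) a e - A i a * A i e - A a j * A e j := by
  rw [hA.dsum_mul, Finset.sum_insert he, Finset.sum_insert ha, Finset.sum_pair hij,
    hA.apply_diag, hA.apply_diag, hA.comm i a, hA.comm e j]
  ring

theorem Matrix.IsAdjMatrix.dsum₃_path (hA : A.IsAdjMatrix) (hij : i ≠ j) :
    dsum₃ {i, j} (fun a b c => A i a * (A a b * (A b c * A c j))) =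
      dsum₂ {i, j} fun a e => A i a * A e j * ((A ^ 2) a e - A i e - A a j) := by
  rw [dsum₃_swap₂₃]
  refine dsum₂_congr fun a e ha he => ?_
  have h := hA.dsum₁_mul_insert₂ ha he hij
  have h1 := hA.sq i a
  have h2 := hA.sq e j
  calc dsum₁ (insert e (insert a {i, j})) (fun b => A i a * (A a b * (A b e * A e j)))
      = A i a * A e j * dsum₁ (insert e (insert a {i, j})) (fun z => A a z * A z e) := by
        rw [← dsum₁_mul_left]
        exact dsum₁_congr fun z _ => by ring
    _ = _ := by
      rw [h]
      linear_combination (-A i e * A e j) * h1 - A i a * A a j * h2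

/-- The weighted sum of the paths `i, a, b, c, d, j` with the weight `K` at the middle edge, in
terms of `b` and `c`. -/
def middleSum (A K : Matrix V V ℤ) (i j : V) : ℤ :=
  dsum₂ {i, j} fun b c => K b c * (((A ^ 2) i b - A i c * A b c - A i j * A b j) *
    ((A ^ 2) c j - A b j * A b c - A i j * A i c) - ∑ a, A i a * A a b * (A c a * A a j))

/-- For fixed `b`, `c` the sums over `a` and `d` separate up to the diagonal `a = d`. Its terms at
`i`, `j`, `b`, `c` vanish, so it may run over all vertices. The weight `K` is free in order to serve
lengths 5 and 6 alike. -/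
theorem Matrix.IsAdjMatrix.dsum₄_middle (hA : A.IsAdjMatrix) (hij : i ≠ j) (K : Matrix V V ℤ) :
    dsum₄ {i, j} (fun a b c d => A i a * A a b * K b c * (A c d * A d j)) =
      middleSum A K i j := by
  rw [dsum₄_swap₁₂, dsum₄_swap₂₃]
  refine dsum₂_congr fun b c hb hc => ?_
  have h1 : dsum₂ (insert c (insert b {i, j})) (fun a d => A i a * A a b * K b c * (A c d * A d j))
      = K b c * dsum₂ (insert c (insert b {i, j}))
        (fun a d => A i a * A a b * (A c d * A d j)) := by
    rw [← dsum₂_mul_left]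
    exact dsum₂_congr fun _ _ _ _ => by ring
  refine h1.trans ?_
  rw [dsum₂_mul, hA.dsum_mul, hA.dsum_mul, dsum₁_eq_sub]
  simp only [Finset.sum_insert hc, Finset.sum_insert hb, Finset.sum_pair hij, hA.apply_diag,
    hA.comm c b, hA.comm b j, hA.comm i c]
  ring

theorem Matrix.IsAdjMatrix.dsum₄_path (hA : A.IsAdjMatrix) (hij : i ≠ j) :
    dsum₄ {i, j} (fun a b c d => A i a * (A a b * (A b c * (A c d * A d j)))) =
      middleSum A A i j := by
  rw [← hA.dsum₄_middle hij]
  exact dsum₄_congr fun _ _ _ _ _ _ _ _ => by ring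

/-- The triangles at `i` that are disjoint from a path `i, d, e, j`, summed over these paths. -/
def triangleSum (A : Matrix V V ℤ) (i j : V) : ℤ :=
  dsum₂ {i, j} fun d e => A i d * A d e * A e j * ((A ^ 3) i i
    - 2 * (A i d * (A ^ 2) i d) - 2 * (A i e * (A ^ 2) i e) - 2 * (A i j * (A ^ 2) i j)
    + 2 * A i e + 2 * (A i j * A d j) + 2 * (A i j * A i e))

/-- Inclusion–exclusion for fixed `d`, `e`: the closed 3-walks at `i`, minus those whose first or
second inner vertex is `d`, `e` or `j`, plus those for which both are. The factor `A i d * A d e * A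
e j` simplifies the corrections. -/
theorem Matrix.IsAdjMatrix.dsum₄_triangle (hA : A.IsAdjMatrix) (hij : i ≠ j) :
    dsum₄ {i, j} (fun a b d e => A i a * A a b * A b i * (A i d * A d e * A e j)) =
      triangleSum A i j := by
  rw [dsum₄_swap₂₃, dsum₄_swap₁₂, dsum₄_swap₃₄, dsum₄_swap₂₃]
  refine dsum₂_congr fun d e hd he => ?_
  simp only [Finset.mem_insert, Finset.mem_singleton, not_or] at hd he
  have hd' : d ∉ ({i, j} : Finset V) := by simp [hd]
  have he' : e ∉ insert d ({i, j} : Finset V) := by simp [he]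
  let t : Finset V := insert e (insert d {i, j})
  have h1 : dsum₂ t (fun a b => A i a * A a b * A b i) = ∑ a, A i a * (A ^ 2) a i
      - ∑ z ∈ t, ∑ a, A i a * A a z * A z i - (∑ z ∈ t, A i z * (A ^ 2) z i
      - ∑ z ∈ t, ∑ w ∈ t, A i z * A z w * A w i) := by
    have h2 : ∀ a, a ∉ t → dsum₁ (insert a t) (fun b => A i a * A a b * A b i) =
        A i a * (A ^ 2) a i - ∑ z ∈ t, A i a * A a z * A z i := fun a ha => by
      rw [dsum₁_eq_sub, Finset.sum_insert ha, hA.apply_diag, pow_two, Matrix.mul_apply,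
        Finset.mul_sum]
      simp only [mul_assoc]
      ring
    refine (dsum₁_congr h2).trans ?_
    rw [dsum₁_eq_sub, Finset.sum_sub_distrib, Finset.sum_sub_distrib, Finset.sum_comm]
  have h3 : ∀ z, ∑ a, A i a * A a z * A z i = A i z * (A ^ 2) i z := fun z => by
    rw [← Finset.sum_mul, pow_two, Matrix.mul_apply, hA.comm i z, mul_comm]
  have h4 : ∑ a, A i a * (A ^ 2) a i = (A ^ 3) i i := by
    rw [pow_succ' A 2, Matrix.mul_apply]
  have h5 : ∀ z, (A ^ 2) z i = (A ^ 2) i z := fun z =>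
    (hA.symm.pow 2).apply i z
  have h6 : dsum₂ t (fun a b => A i a * A a b * A b i * (A i d * A d e * A e j)) =
      (A i d * A d e * A e j) * dsum₂ t (fun a b => A i a * A a b * A b i) := by
    rw [← dsum₂_mul_left]
    exact dsum₂_congr fun _ _ _ _ => by ring
  refine h6.trans ?_
  rw [h1, h4]
  simp only [h3, h5, t, Finset.sum_insert hd', Finset.sum_insert he', Finset.sum_pair hij,
    hA.apply_diag, hA.comm i j, hA.comm i d, hA.comm i e, hA.comm d e, hA.comm e j, hA.comm d j]
  rcases hA.zero_or_one i d with h | h <;> rcases hA.zero_or_one d e with h' | h' <;>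
    rcases hA.zero_or_one e j with h'' | h'' <;> simp only [h, h', h''] <;> ring

/-- The edges at `a` that end outside of a path `i, a, d, e, j`, summed over these paths. -/
def pendantSum (A : Matrix V V ℤ) (i j : V) : ℤ :=
  dsum₂ {i, j} fun a e => A i a * A e j * (((A ^ 2) a e - A i e - A a j) *
    (∑ x, A a x - 2 - A a e - A a j))

/-- The end `b` of the extra edge ranges over the neighbors of `a` outside the path. Of the path
vertices, `i` and `d` are always neighbors, hence the `2`; `e` and `j` may be. -/
theorem Matrix.IsAdjMatrix.dsum₄_pendant (hA : A.IsAdjMatrix) (hij : i ≠ j) :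
    dsum₄ {i, j} (fun a b d e => A i a * A a b * A a d * (A d e * A e j)) =
      pendantSum A i j := by
  rw [dsum₄_swap₂₃, dsum₄_swap₃₄, dsum₄_swap₂₃]
  refine dsum₂_congr fun a e ha he => ?_
  have h := hA.dsum₁_mul_insert₂ ha he hij
  let t : Finset V := insert e (insert a {i, j})
  have h1 : ∀ d, d ∉ t → dsum₁ (insert d t) (fun b => A i a * A a b * A a d * (A d e * A e j)) =
      A i a * A e j * (∑ x, A a x - 2 - A a e - A a j) * (A a d * A d e) := fun d hd => by
    have h2 : dsum₁ (insert d t) (fun b => A i a * A a b * A a d * (A d e * A e j)) =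
        A i a * A a d * (A d e * A e j) * dsum₁ (insert d t) (A a) := by
      rw [← dsum₁_mul_left]
      exact dsum₁_congr fun _ _ => by ring
    rw [h2, dsum₁_eq_sub, Finset.sum_insert hd, Finset.sum_insert he, Finset.sum_insert ha,
      Finset.sum_pair hij, hA.apply_diag, hA.comm i a]
    linear_combination (-A a d * A d e * A e j) * hA.sq i a -
      A i a * A d e * A e j * hA.sq a d
  refine (dsum₁_congr h1).trans ?_
  rw [dsum₁_mul_left, h]
  have h1 := hA.sq i a
  have h2 := hA.sq e j
  linear_combination (∑ x, A a x - 2 - A a e - A a j) * (-A i e * A e j * h1 -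
    A i a * A a j * h2)

/-- Summing out the middle vertex `c` gives `(A²) b d` minus the terms `c = i, j, a, e`. The first
two are triangles at the ends, the last two pendant edges at `a` and `e`; reversing the path pairs
them up. -/
theorem Matrix.IsAdjMatrix.dsum₅_path (hA : A.IsAdjMatrix) (hij : i ≠ j) :
    dsum₅ {i, j} (fun a b c d e => A i a * (A a b * (A b c * (A c d * (A d e * A e j))))) =
      middleSum A (A ^ 2) i j - triangleSum A i j - triangleSum A j i - pendantSum A i j -
        pendantSum A j i := by
  have hr : ∀ g : V → V → V → V → ℤ, dsum₄ {j, i} g = dsum₄ {i, j} fun a b d e => g e d b a :=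
    fun g => by rw [Finset.pair_comm, dsum₄_reverse]
  rw [← hA.dsum₄_middle hij, ← hA.dsum₄_triangle hij, ← hA.dsum₄_triangle hij.symm,
    ← hA.dsum₄_pendant hij, ← hA.dsum₄_pendant hij.symm, hr, hr, ← dsum₄_sub, ← dsum₄_sub,
    ← dsum₄_sub, ← dsum₄_sub, dsum₅_swap₃₄, dsum₅_swap₄₅]
  refine dsum₄_congr fun a b d e ha hb hd he => ?_
  have h1 : dsum₁ (insert e (insert d (insert b (insert a {i, j}))))
      (fun c => A i a * (A a b * (A b c * (A c d * (A d e * A e j))))) =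
      A i a * A a b * (A d e * A e j) *
        dsum₁ (insert e (insert d (insert b (insert a {i, j})))) (fun c => A b c * A c d) := by
    rw [← dsum₁_mul_left]
    exact dsum₁_congr fun _ _ => by ring
  refine h1.trans ?_
  rw [hA.dsum_mul, Finset.sum_insert he, Finset.sum_insert hd, Finset.sum_insert hb,
    Finset.sum_insert ha, Finset.sum_pair hij, hA.apply_diag, hA.apply_diag]
  have h2 := hA.sq a b
  have h3 := hA.sq d e
  rw [hA.comm a b, hA.comm d e, hA.comm e j, hA.comm b e, hA.comm b j, hA.comm i a, hA.comm d j]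
  linear_combination (-A i a * A a b * A e j * A b e) * h3 - A i a * A d e * A e j * A a d * h2

end Elimination

/-! ### The number of layers that each operation costs -/

section Classes

open FeatureLevel

variable {N m q k : ℕ}

theorem isAdjMatrix_adj (I : GraphInput.{u} N m) : (adj I).IsAdjMatrix :=
  SimpleGraph.isAdjMatrix_adjMatrix ℤ I.G

/-- `F` agrees at all pairs of distinct nodes with a pair feature of level `k`. -/
def OffPair (q k : ℕ) (F : (I : GraphInput.{u} N m) → I.V → I.V → ℤ) : Prop :=
  ∃ F' : PairFeature.{u} N m, (level q k).IsPair q F' ∧ ∀ I i j, i ≠ j → F I i j = F' I i j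

/-- `F` is a pair feature of level `k`. -/
abbrev FullPair (q k : ℕ) (F : (I : GraphInput.{u} N m) → I.V → I.V → ℤ) : Prop :=
  (level q k).IsPair q fun I => Matrix.of (F I)

/-- `φ` is a node feature that the mixer computes from the features of level `k`. -/
abbrev MixerNode (q k : ℕ) (φ : NodeFeature.{u} N m) : Prop := (level q k).IsNode q φ

variable {F G : (I : GraphInput.{u} N m) → I.V → I.V → ℤ} {φ : NodeFeature.{u} N m}

theorem FullPair.offPair (hF : FullPair q k F) : OffPair q k F := ⟨_, hF, fun _ _ _ _ => rfl⟩

theorem OffPair.congr (h : ∀ I i j, i ≠ j → G I i j = F I i j) (hF : OffPair q k F) :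
    OffPair q k G := by
  obtain ⟨F', h1, h2⟩ := hF
  exact ⟨F', h1, fun I i j hij => (h I i j hij).trans (h2 I i j hij)⟩

theorem OffPair.map₂ (op : ℤ → ℤ → ℤ) (hF : OffPair q k F) (hG : OffPair q k G) :
    OffPair q k fun I i j => op (F I i j) (G I i j) := by
  obtain ⟨F', h1, h2⟩ := hF
  obtain ⟨G', h3, h4⟩ := hG
  exact ⟨_, h1.map₂ op h3, fun I i j hij => congrArg₂ op (h2 I i j hij) (h4 I i j hij)⟩

theorem OffPair.add (hF : OffPair q k F) (hG : OffPair q k G) :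
    OffPair q k fun I i j => F I i j + G I i j := hF.map₂ _ hG

theorem OffPair.sub (hF : OffPair q k F) (hG : OffPair q k G) :
    OffPair q k fun I i j => F I i j - G I i j := hF.map₂ _ hG

theorem OffPair.mul (hF : OffPair q k F) (hG : OffPair q k G) :
    OffPair q k fun I i j => F I i j * G I i j := hF.map₂ _ hG

theorem offPair_const (c : ℤ) :
    OffPair q k fun (I : GraphInput.{u} N m) (_ _ : I.V) => c :=
  ⟨_, isPair_const c, fun _ _ _ _ => rfl⟩

theorem OffPair.swap (hF : OffPair q k F) : OffPair q k fun I i j => F I j i := by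
  obtain ⟨F', h1, h2⟩ := hF
  exact ⟨_, h1.transpose, fun I i j hij => h2 I j i hij.symm⟩

theorem OffPair.succ (hF : OffPair q k F) : OffPair q (k + 1) F := by
  obtain ⟨F', h1, h2⟩ := hF
  exact ⟨F', h1.level_succ, h2⟩

theorem OffPair.left (hφ : MixerNode q k φ) : OffPair q (k + 1) fun I i _ => φ I i :=
  ⟨_, isPair_left_of_mem_next hφ.mem_next, fun _ _ _ _ => rfl⟩

theorem OffPair.right (hφ : MixerNode q k φ) : OffPair q (k + 1) fun I _ j => φ I j :=
  (OffPair.left hφ).swap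

theorem fullPair_pow {p : ℕ} (hp : 1 ≤ p) (hpq : p ≤ q) :
    FullPair (N := N) (m := m) q k fun (I : GraphInput.{u} N m) i j => (adj I ^ p) i j := by
  have := isPair_gram (q := q) (one_mem_level_mat (N := N) (m := m) (q := q) k)
    (one_mem_level_mat k) hp hpq
  convert this using 2 with I
  simp only [gram, Pi.one_apply, Matrix.one_mul, Matrix.transpose_one, Matrix.mul_one]
  rfl

theorem fullPair_adj (hq : 1 ≤ q) :
    FullPair (N := N) (m := m) q k fun (I : GraphInput.{u} N m) i j => adj I i j := by
  simpa using fullPair_pow (N := N) (m := m) (k := k) le_rfl hq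

theorem offPair_pow {p : ℕ} (hp : 1 ≤ p) (hpq : p ≤ q) :
    OffPair (N := N) (m := m) q k fun (I : GraphInput.{u} N m) i j => (adj I ^ p) i j :=
  (fullPair_pow hp hpq).offPair

theorem offPair_adj (hq : 1 ≤ q) :
    OffPair (N := N) (m := m) q k fun (I : GraphInput.{u} N m) i j => adj I i j :=
  (fullPair_adj hq).offPair

theorem mixerNode_pow {p : ℕ} (hp : 1 ≤ p) (hpq : p ≤ q) :
    MixerNode (N := N) (m := m) q k fun (I : GraphInput.{u} N m) i => (adj I ^ p) i i :=
  (fullPair_pow hp hpq).diag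

theorem FullPair.mul (hF : FullPair q k F) (hG : FullPair q k G) :
    FullPair q k fun I i j => F I i j * G I i j := hF.map₂ _ hG

theorem MixerNode.sub {ψ : NodeFeature.{u} N m} (hφ : MixerNode q k φ) (hψ : MixerNode q k ψ) :
    MixerNode q k fun I i => φ I i - ψ I i := hφ.map₂ _ hψ

theorem FullPair.sum_node (hF : FullPair q k F) (hφ : MixerNode q k φ) :
    MixerNode q (k + 1) fun I i => ∑ a, F I i a * φ I a :=
  isNode_of_mem (IsPair.sum_mem_next hF hφ)

theorem FullPair.sum (hF : FullPair q k F) : MixerNode q (k + 1) fun I i => ∑ a, F I i a := by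
  simpa using hF.sum_node (isNode_const 1)

/-- Matrix product with powers of the adjacency matrix. -/
theorem FeatureLevel.IsPair.sum_mul_pow {F : PairFeature.{u} N m} (hF : (level q k).IsPair q F)
    (hφ : MixerNode q k φ) {p : ℕ} (hp : 1 ≤ p) (hpq : p ≤ q) :
    FullPair q (k + 1) fun I i j => ∑ a, F I i a * φ I a * (adj I ^ p) a j := by
  have := isPair_gram (q := q) (hF.mul_mem_next hφ (one_mem_level_mat k))
    (one_mem_level_mat (k + 1)) hp hpq
  refine (congrArg ((level q (k + 1)).IsPair q) (funext fun I => ?_)).mp this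
  ext i j
  simp only [gram, Pi.one_apply, Matrix.transpose_one, Matrix.mul_one, Matrix.of_apply]
  rw [Matrix.mul_apply]
  simp only [Matrix.mul_diagonal]

/-- One aggregation gives the sum over all `b`; the terms `b = i` and `b = j` are subtracted. Only
pairs of distinct nodes remain, so the diagonal of the representative `F'` is irrelevant. -/
theorem OffPair.dsum_node (hF : OffPair q k F) (hφ : MixerNode q k φ) :
    OffPair q (k + 1) fun I i j => dsum₁ {i, j} fun b => F I i b * φ I b := by
  obtain ⟨F', h1, h2⟩ := hF
  have h3 : OffPair q (k + 1) fun I i _ => ∑ a, F' I i a * φ I a :=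
    ⟨_, isPair_left_of_mem_next (IsPair.sum_mem_next h1 hφ), fun _ _ _ _ => rfl⟩
  refine OffPair.congr (fun I i j hij => ?_) ((h3.sub ((OffPair.left h1.diag).mul
    (OffPair.left hφ))).sub ((OffPair.succ ⟨F', h1, fun _ _ _ _ => rfl⟩).mul (OffPair.right hφ)))
  refine Eq.trans (dsum₁_congr fun b hb => ?_) (dsum₁_pair hij fun b => F' I i b * φ I b)
  rw [h2 I i b fun h => hb (by simp [h])]

theorem OffPair.dsum (hF : OffPair q k F) :
    OffPair q (k + 1) fun I i j => dsum₁ {i, j} fun b => F I i b := by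
  simpa using hF.dsum_node (isNode_const 1)

/-- The aggregated vectors `F diag(φ) U` have inner products `F diag(φ) Aᵖ` with `U Λᵖ`, again up to
the terms at `i` and `j`. -/
theorem OffPair.dsum_node_pow (hF : OffPair q k F) (hφ : MixerNode q k φ) {p : ℕ} (hp : 1 ≤ p)
    (hpq : p ≤ q) :
    OffPair q (k + 1) fun I i j => dsum₁ {i, j} fun a => F I i a * φ I a * (adj I ^ p) a j := by
  obtain ⟨F', h1, h2⟩ := hF
  refine OffPair.congr (fun I i j hij => ?_) (((IsPair.sum_mul_pow h1 hφ hp hpq).offPair.sub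
    (((OffPair.left h1.diag).mul (OffPair.left hφ)).mul (offPair_pow hp hpq))).sub
      (((OffPair.succ ⟨F', h1, fun _ _ _ _ => rfl⟩).mul (OffPair.right hφ)).mul
        (OffPair.right (mixerNode_pow hp hpq))))
  refine Eq.trans (dsum₁_congr fun b hb => ?_)
    (dsum₁_pair hij fun a => F' I i a * φ I a * (adj I ^ p) a j)
  rw [h2 I i b fun h => hb (by simp [h])]

theorem OffPair.dsum_node_adj (hF : OffPair q k F) (hφ : MixerNode q k φ) (hq : 1 ≤ q) :
    OffPair q (k + 1) fun I i j => dsum₁ {i, j} fun a => F I i a * φ I a * adj I a j := by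
  simpa using hF.dsum_node_pow hφ le_rfl hq

theorem OffPair.dsum_pow (hF : OffPair q k F) {p : ℕ} (hp : 1 ≤ p) (hpq : p ≤ q) :
    OffPair q (k + 1) fun I i j => dsum₁ {i, j} fun a => F I i a * (adj I ^ p) a j := by
  simpa using hF.dsum_node_pow (isNode_const 1) hp hpq

theorem OffPair.dsum_adj (hF : OffPair q k F) (hq : 1 ≤ q) :
    OffPair q (k + 1) fun I i j => dsum₁ {i, j} fun a => F I i a * adj I a j := by
  simpa using hF.dsum_pow le_rfl hq

theorem adj_pow_comm (I : GraphInput.{u} N m) (p : ℕ) (x y : I.V) :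
    (adj I ^ p) y x = (adj I ^ p) x y :=
  ((isAdjMatrix_adj I).symm.pow p).apply x y

theorem OffPair.pow_dsum (hF : OffPair q k F) {p : ℕ} (hp : 1 ≤ p) (hpq : p ≤ q) :
    OffPair q (k + 1) fun I i j => dsum₁ {i, j} fun a => (adj I ^ p) i a * F I a j := by
  refine OffPair.congr (fun I i j hij => ?_) (hF.swap.dsum_pow hp hpq).swap
  rw [Finset.pair_comm]
  exact dsum₁_congr fun a _ => by rw [mul_comm, adj_pow_comm I p a i]

theorem OffPair.adj_dsum (hF : OffPair q k F) (hq : 1 ≤ q) :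
    OffPair q (k + 1) fun I i j => dsum₁ {i, j} fun a => adj I i a * F I a j := by
  simpa using hF.pow_dsum le_rfl hq

theorem adj_pow_add (I : GraphInput.{u} N m) (p r : ℕ) (x y : I.V) :
    ∑ z, (adj I ^ p) x z * (adj I ^ r) z y = (adj I ^ (p + r)) x y := by
  rw [pow_add, Matrix.mul_apply]

/-- The sum of `F i b * (Aᵖ) b c * (Aʳ) c j` over distinct `b`, `c`. -/
theorem OffPair.dsum₂_pow_pow (hF : OffPair q k F) {p r : ℕ} (hp : 1 ≤ p) (hr : 1 ≤ r)
    (hq : p + r ≤ q) : OffPair q (k + 1) fun I i j =>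
      dsum₂ {i, j} fun b c => F I i b * ((adj I ^ p) b c * (adj I ^ r) c j) := by
  have hp' : p ≤ q := by omega
  have hr' : r ≤ q := by omega
  -- Summing over `c` first yields `Aᵖ⁺ʳ` and the corrections `c = b, i, j`. A double sum thus costs
  -- only one layer.
  refine OffPair.congr (fun I i j hij => ?_)
    ((((hF.dsum_pow (by omega) hq).sub (hF.dsum_node_pow (mixerNode_pow hp hp') hr hr')).sub
      ((hF.mul (offPair_pow hp hp')).dsum.mul (offPair_pow hr hr'))).sub
      ((hF.dsum_pow hp hp').mul (OffPair.right (mixerNode_pow hr hr'))))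
  rw [dsum₂_eq_left hij, mul_comm (dsum₁ {i, j} fun b => F I i b * (adj I ^ p) i b),
    mul_comm (dsum₁ {i, j} fun a => F I i a * (adj I ^ p) a j), ← dsum₁_mul_left,
    ← dsum₁_mul_left, ← dsum₁_sub, ← dsum₁_sub, ← dsum₁_sub]
  refine dsum₁_congr fun b _ => ?_
  rw [adj_pow_add, adj_pow_comm I p i b]
  ring

/-- The sum of `A i a * B a e * A e j` over distinct `a`, `e`. -/
theorem FullPair.dsum₂_adj_adj (hF : FullPair q k F) (h0 : ∀ I a, F I a a = 0) (hq : 1 ≤ q) :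
    OffPair q (k + 2) fun I i j =>
      dsum₂ {i, j} fun a e => adj I i a * (F I a e * adj I e j) := by
  -- `F` need not be a power of `A`, so two successive aggregations build the vectors `A F U`; the
  -- last factor `A` comes from the inner product.
  have hABA : FullPair q (k + 2) fun I i j => ∑ a, adj I i a * ∑ e, F I a e * adj I e j := by
    have h1 := IsPair.mul_mem_next hF (isNode_const 1) (one_mem_level_mat (q := q) k)
    have h2 := IsPair.mul_mem_next (fullPair_adj (N := N) (m := m) (q := q) (k := k + 1) hq)
      (isNode_const 1) h1
    have := isPair_gram (q := q) h2 (one_mem_level_mat (k + 2)) le_rfl hq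
    refine (congrArg ((level q (k + 2)).IsPair q) (funext fun I => ?_)).mp this
    have h3 : (Matrix.diagonal fun _ => 1 : Matrix I.V I.V ℤ) = 1 := Matrix.diagonal_one
    have h4 : (Matrix.of fun i j => adj I i j) = adj I := rfl
    simp only [gram, Pi.one_apply, Matrix.transpose_one, Matrix.mul_one, pow_one, h3, h4,
      Matrix.mul_assoc]
    ext i j
    simp only [Matrix.of_apply, Matrix.mul_apply]
  have hAF := (hF.mul (fullPair_adj hq)).sum
  refine OffPair.congr (fun I i j hij => ?_) ((hABA.offPair.sub
    ((offPair_adj hq).mul (OffPair.right hAF))).sub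
      ((((offPair_adj (k := k) hq).mul hF.offPair.swap).dsum.mul (offPair_adj hq)).succ))
  rw [dsum₂_eq_left hij, mul_comm (dsum₁ {i, j} fun b => adj I i b * F I b i),
    ← dsum₁_mul_left]
  have h6 := dsum₁_pair hij fun a => adj I i a * ∑ e, F I a e * adj I e j
  rw [(isAdjMatrix_adj I).apply_diag, zero_mul, sub_zero] at h6
  have h7 : ∑ a, F I j a * adj I j a = ∑ a, F I j a * adj I a j :=
    Finset.sum_congr rfl fun a _ => by rw [(isAdjMatrix_adj I).comm a j]
  rw [h7, ← h6, ← dsum₁_sub]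
  refine dsum₁_congr fun b _ => ?_
  rw [h0, (isAdjMatrix_adj I).apply_diag]
  ring

end Classes

/-! ### Expansion into sums over one vertex at a time -/

section Expansions

variable {V : Type*} [Fintype V] [DecidableEq V] {A : Matrix V V ℤ} {i j : V}

/-- Degrees are diagonal entries of `A²`, which a mixer reads off without attention. -/
theorem Matrix.IsAdjMatrix.sum_row (hA : A.IsAdjMatrix) (x : V) : ∑ z, A x z = (A ^ 2) x x := by
  rw [← hA.sum_mul]
  exact Finset.sum_congr rfl fun z _ => (hA.sq x z).symm

theorem Matrix.IsAdjMatrix.sum_mul' (_hA : A.IsAdjMatrix) (x y : V) :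
    ∑ z, A x z * A z y = (A ^ 2) x y := by
  rw [pow_two, Matrix.mul_apply]

theorem Matrix.IsAdjMatrix.pow_comm (hA : A.IsAdjMatrix) (p : ℕ) (x y : V) :
    (A ^ p) y x = (A ^ p) x y :=
  (hA.symm.pow p).apply x y

theorem dsum₂_sum {ι : Type*} (t : Finset ι) (s : Finset V) (g : ι → V → V → ℤ) :
    dsum₂ s (fun b c => ∑ a ∈ t, g a b c) = ∑ a ∈ t, dsum₂ s (g a) := by
  simp only [dsum₂, dsum₁]
  rw [Finset.sum_comm]
  exact Finset.sum_congr rfl fun _ _ => Finset.sum_comm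

/-- Given `a`, the vertex `e` is any neighbor of `j` other than `i` and `a`, and `a` is one of them.
-/
theorem Matrix.IsAdjMatrix.dsum₂_cherry_left (hA : A.IsAdjMatrix) (hij : i ≠ j) (f : V → ℤ) :
    dsum₂ {i, j} (fun a e => A i a * A a j * f a * A e j) =
      ((A ^ 2) j j - A i j - 1) * dsum₁ {i, j} fun a => A i a * f a * A a j := by
  rw [dsum₂_eq_left hij _ fun a e => A e j, ← dsum₁_mul_left]
  refine dsum₁_congr fun a _ => ?_
  have : ∑ e, A e j = (A ^ 2) j j := by
    rw [← hA.sum_row]; exact Finset.sum_congr rfl fun e _ => hA.comm j e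
  rw [this, hA.apply_diag]
  linear_combination (-A i a * f a) * hA.sq a j

theorem Matrix.IsAdjMatrix.dsum₂_cherry_right (hA : A.IsAdjMatrix) (hij : i ≠ j) (w : V → ℤ) :
    dsum₂ {i, j} (fun a e => A i e * A e j * (A i a * w a)) =
      (∑ a, A i a * w a - A i j * w j) * dsum₁ {i, j} (fun e => A i e * A e j) -
        dsum₁ {i, j} fun e => A i e * w e * A e j := by
  rw [dsum₂_eq_right hij _ fun a e => A i a * w a, ← dsum₁_mul_left, ← dsum₁_sub]
  refine dsum₁_congr fun e _ => ?_
  rw [hA.apply_diag]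
  linear_combination (-A e j * w e) * hA.sq i e

theorem Matrix.IsAdjMatrix.dsum₂_path_four (hA : A.IsAdjMatrix) (hij : i ≠ j) :
    dsum₂ {i, j} (fun a e => A i a * A e j * ((A ^ 2) a e - A i e - A a j)) =
      dsum₂ {i, j} (fun a e => A i a * ((A ^ 2) a e * A e j)) -
        ((A ^ 2) i i - A i j - 1) * dsum₁ {i, j} (fun e => A i e * A e j) -
        ((A ^ 2) j j - A i j - 1) * dsum₁ {i, j} (fun e => A i e * A e j) := by
  have h1 := hA.dsum₂_cherry_left hij fun _ => 1
  have h2 := hA.dsum₂_cherry_right hij fun _ => 1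
  simp only [mul_one] at h1 h2
  rw [hA.sum_row] at h2
  have h3 : dsum₂ {i, j} (fun a e => A i a * A e j * ((A ^ 2) a e - A i e - A a j)) =
      dsum₂ {i, j} (fun a e => A i a * ((A ^ 2) a e * A e j)) -
        dsum₂ {i, j} (fun a e => A i e * A e j * A i a) -
        dsum₂ {i, j} (fun a e => A i a * A a j * A e j) := by
    rw [← dsum₂_sub, ← dsum₂_sub]
    exact dsum₂_congr fun a e _ _ => by ring
  rw [h3, h1, h2]; ring

/-- The nine products of the two brackets of `pendantSum`, in order, with the degree of `a` written
as `(A ^ 2) a a`. -/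
theorem Matrix.IsAdjMatrix.pendantSum_eq (hA : A.IsAdjMatrix) (hij : i ≠ j) :
    pendantSum A i j =
      dsum₂ {i, j} (fun a e => A i a * ((A ^ 2) a a - 2) * ((A ^ 2) a e * A e j))
      - dsum₂ {i, j} (fun a e => A i a * (A a e * (A ^ 2) a e * A e j))
      - (dsum₁ {i, j} (fun a => A i a * (A a j * (A ^ 3) a j))
        - dsum₁ {i, j} (fun a => A i a * (A ^ 2) a a * A a j)
        - A i j * dsum₁ {i, j} (fun a => A i a * (A ^ 2) i a * A a j))
      - ((∑ a, A i a * ((A ^ 2) a a - 2) - A i j * ((A ^ 2) j j - 2)) *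
          dsum₁ {i, j} (fun e => A i e * A e j) -
        dsum₁ {i, j} fun e => A i e * ((A ^ 2) e e - 2) * A e j)
      + (dsum₁ {i, j} (fun e => A i e * (A ^ 2) i e * A e j)
        - A i j * dsum₁ {i, j} (fun e => A i e * A e j))
      + ((A ^ 2) i j - 1) * dsum₁ {i, j} (fun a => A i a * A a j)
      - ((A ^ 2) j j - A i j - 1) * dsum₁ {i, j} (fun a => A i a * ((A ^ 2) a a - 2) * A a j)
      + (dsum₁ {i, j} (fun a => A i a * (A a j * (A ^ 2) a j))
        - A i j * dsum₁ {i, j} (fun a => A i a * A a j))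
      + ((A ^ 2) j j - A i j - 1) * dsum₁ {i, j} (fun a => A i a * A a j) := by
  have h1 := hA.dsum₂_cherry_left hij fun _ => 1
  simp only [mul_one] at h1
  rw [← hA.dsum₂_cherry_left hij, ← hA.dsum₂_cherry_right hij, ← h1]
  have h3 : dsum₁ {i, j} (fun a => A i a * (A a j * (A ^ 3) a j))
        - dsum₁ {i, j} (fun a => A i a * (A ^ 2) a a * A a j)
        - A i j * dsum₁ {i, j} (fun a => A i a * (A ^ 2) i a * A a j) =
      dsum₂ {i, j} fun a e => A i a * A a j * ((A ^ 2) a e * A e j) := by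
    rw [dsum₂_eq_left hij _ fun a e => (A ^ 2) a e * A e j, ← dsum₁_mul_left, ← dsum₁_sub,
      ← dsum₁_sub]
    refine dsum₁_congr fun a _ => ?_
    have : ∑ e, (A ^ 2) a e * A e j = (A ^ 3) a j := by rw [pow_succ A 2, Matrix.mul_apply]
    rw [this, hA.apply_diag, hA.pow_comm 2 i a]
    linear_combination A i a * (A ^ 2) a a * hA.sq a j
  have h5 : dsum₁ {i, j} (fun e => A i e * (A ^ 2) i e * A e j)
        - A i j * dsum₁ {i, j} (fun e => A i e * A e j) =
      dsum₂ {i, j} fun a e => A i e * A e j * (A i a * A a e) := by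
    rw [dsum₂_eq_right hij _ fun a e => A i a * A a e, ← dsum₁_mul_left, ← dsum₁_sub]
    refine dsum₁_congr fun e _ => ?_
    rw [hA.sum_mul', hA.apply_diag, hA.apply_diag, hA.comm e j]
    linear_combination A i j * A i e * hA.sq e j
  have h6 : ((A ^ 2) i j - 1) * dsum₁ {i, j} (fun a => A i a * A a j) =
      dsum₂ {i, j} fun a e => A i a * A a j * (A i e * A e j) := by
    rw [dsum₂_eq_left hij _ fun a e => A i e * A e j, ← dsum₁_mul_left]
    refine dsum₁_congr fun a _ => ?_
    rw [hA.sum_mul', hA.apply_diag, hA.apply_diag]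
    linear_combination A a j * A a j * hA.sq i a + A i a * hA.sq a j
  have h8 : dsum₁ {i, j} (fun a => A i a * (A a j * (A ^ 2) a j))
        - A i j * dsum₁ {i, j} (fun a => A i a * A a j) =
      dsum₂ {i, j} fun a e => A i a * A a j * (A a e * A e j) := by
    rw [dsum₂_eq_left hij _ fun a e => A a e * A e j, ← dsum₁_mul_left, ← dsum₁_sub]
    refine dsum₁_congr fun a _ => ?_
    rw [hA.sum_mul', hA.apply_diag, hA.apply_diag, hA.comm i a]
    linear_combination A i j * A a j * hA.sq i a
  rw [h3, h5, h6, h8]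
  simp only [← dsum₂_sub, ← dsum₂_add]
  refine dsum₂_congr fun a e _ _ => ?_
  rw [hA.sum_row]
  linear_combination A i a * A e j * hA.sq a j

theorem Matrix.IsAdjMatrix.triangleSum_eq (hA : A.IsAdjMatrix) (hij : i ≠ j) :
    triangleSum A i j =
      ((A ^ 3) i i - 2 * (A i j * (A ^ 2) i j)) *
          dsum₂ {i, j} (fun d e => A i d * (A d e * A e j))
      - 2 * dsum₂ {i, j} (fun d e => A i d * (A ^ 2) i d * (A d e * A e j))
      + 2 * (dsum₁ {i, j} (fun e => A i e * ((1 - (A ^ 2) i e) * (A ^ 2) i e) * A e j)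
        + A i j * dsum₁ {i, j} (fun e => A i e * (2 * (A ^ 2) i e - 2) * A e j))
      + 2 * A i j * (dsum₁ {i, j} (fun d => A i d * (A d j * (A ^ 2) d j))
        - A i j * dsum₁ {i, j} (fun d => A i d * A d j)) := by
  have h3 : dsum₁ {i, j} (fun e => A i e * ((1 - (A ^ 2) i e) * (A ^ 2) i e) * A e j)
        + A i j * dsum₁ {i, j} (fun e => A i e * (2 * (A ^ 2) i e - 2) * A e j) =
      dsum₂ {i, j} fun d e => A i e * A e j * (1 - (A ^ 2) i e + A i j) * (A i d * A d e) := by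
    rw [dsum₂_eq_right hij (fun e => A i e * A e j * (1 - (A ^ 2) i e + A i j))
      fun d e => A i d * A d e, ← dsum₁_mul_left, ← dsum₁_add]
    refine dsum₁_congr fun e _ => ?_
    rw [hA.sum_mul', hA.apply_diag, hA.apply_diag, hA.comm e j]
    linear_combination (A i e * A i j * (1 - (A ^ 2) i e + A i j)) * hA.sq e j +
      A i e * A e j * hA.sq i j
  have h4 : dsum₁ {i, j} (fun d => A i d * (A d j * (A ^ 2) d j))
        - A i j * dsum₁ {i, j} (fun d => A i d * A d j) =
      dsum₂ {i, j} fun d e => A i d * A d j * (A d e * A e j) := by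
    rw [dsum₂_eq_left hij _ fun d e => A d e * A e j, ← dsum₁_mul_left, ← dsum₁_sub]
    refine dsum₁_congr fun d _ => ?_
    rw [hA.sum_mul', hA.apply_diag, hA.apply_diag, hA.comm i d]
    linear_combination A i j * A d j * hA.sq i d
  rw [h3, h4, mul_assoc 2 (A i j)]
  simp only [← dsum₂_mul_left, ← dsum₂_sub, ← dsum₂_add]
  refine dsum₂_congr fun d e _ _ => ?_
  linear_combination (-2 * (A ^ 2) i d * A d e * A e j) * hA.sq i d

/-- Nine products of the two brackets, and the diagonal term. In the latter the common neighbor `a`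
is moved outside, so that `b` and `c` become neighbors of `a`. -/
theorem Matrix.IsAdjMatrix.middleSum_eq (hA : A.IsAdjMatrix) (K : Matrix V V ℤ) :
    middleSum A K i j =
      dsum₂ {i, j} (fun b c => (A ^ 2) i b * (K b c * (A ^ 2) c j))
      - dsum₂ {i, j} (fun b c => (A ^ 2) i b * A b j * (A b c * K b c))
      - A i j * dsum₂ {i, j} (fun b c => (A ^ 2) i b * (K b c * A c i))
      - dsum₂ {i, j} (fun b c => A i c * (A ^ 2) c j * (A b c * K b c))
      + dsum₂ {i, j} (fun b c => A i c * (A b c * K b c * A b j))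
      + A i j * dsum₂ {i, j} (fun b c => A i c * (A b c * K b c))
      - A i j * dsum₂ {i, j} (fun b c => (A ^ 2) c j * (K b c * A b j))
      + A i j * dsum₂ {i, j} (fun b c => A b j * (A b c * K b c))
      + A i j * dsum₂ {i, j} (fun b c => A i c * (K b c * A b j))
      - ∑ a, A i a * A a j * dsum₂ {i, j} (fun b c => A a b * (A a c * K b c)) := by
  simp only [← dsum₂_mul_left]
  rw [← dsum₂_sum]
  simp only [← dsum₂_sub, ← dsum₂_add]
  refine dsum₂_congr fun b c _ _ => ?_
  have h : ∑ a, A i a * A a b * (A c a * A a j) * K b c =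
      ∑ a, A i a * A a j * (A a b * (A a c * K b c)) :=
    Finset.sum_congr rfl fun a _ => by rw [hA.comm a c]; ring
  rw [← h, ← Finset.sum_mul, hA.comm i c]
  linear_combination K b c * (A i c * A b j * hA.sq b c + A b c * A i j * hA.sq i c +
    A i j * A b c * hA.sq b j + A b j * A i c * hA.sq i j)

/-- Pairs of neighbors of a common neighbor of `i` and `j`. -/
theorem Matrix.IsAdjMatrix.sum_dsum₂_star (hA : A.IsAdjMatrix) (hij : i ≠ j) (p : ℕ) :
    ∑ a, A i a * A a j * dsum₂ {i, j} (fun b c => A a b * (A a c * (A ^ p) b c)) =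
      dsum₁ {i, j} (fun a => A i a *
        (∑ b, A a b * (A ^ (p + 1)) a b - ∑ b, A a b * (A ^ p) b b) * A a j)
      - 2 * dsum₁ {i, j} (fun a => A i a * (A ^ (p + 1)) i a * A a j)
      - 2 * dsum₁ {i, j} (fun a => A i a * (A a j * (A ^ (p + 1)) a j))
      + (2 * (A ^ p) i i + 2 * (A ^ p) j j + 2 * (A ^ p) i j) *
        dsum₁ {i, j} (fun a => A i a * A a j) := by
  have h1 := dsum₁_pair hij fun a =>
    A i a * A a j * dsum₂ {i, j} (fun b c => A a b * (A a c * (A ^ p) b c))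
  rw [hA.apply_diag, hA.apply_diag, zero_mul, mul_zero, zero_mul, zero_mul, sub_zero,
    sub_zero] at h1
  rw [← h1]
  simp only [← dsum₁_mul_left, ← dsum₁_sub, ← dsum₁_add]
  refine dsum₁_congr fun a _ => ?_
  have h2 : ∀ b, ∑ c, A a c * (A ^ p) b c = (A ^ (p + 1)) a b := fun b => by
    rw [pow_succ', Matrix.mul_apply]
    exact Finset.sum_congr rfl fun c _ => by rw [hA.pow_comm p c b]
  have h3 : ∀ x, ∑ b, A a b * (A a x * (A ^ p) b x) = A a x * (A ^ (p + 1)) a x := fun x => by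
    rw [pow_succ', Matrix.mul_apply, Finset.mul_sum]
    exact Finset.sum_congr rfl fun c _ => by ring
  have h4 : ∑ b, A a b * (A a b * (A ^ p) b b) = ∑ b, A a b * (A ^ p) b b :=
    Finset.sum_congr rfl fun b _ => by rw [← mul_assoc, hA.sq]
  rw [dsum₂_eq_left hij (A a) fun b c => A a c * (A ^ p) b c, dsum₁_pair hij]
  simp only [mul_sub, Finset.sum_sub_distrib, h2, h3, h4]
  rw [hA.pow_comm p i j, hA.comm i a, hA.pow_comm (p + 1) i a]
  rcases hA.zero_or_one i a with h | h <;> rcases hA.zero_or_one a j with h' | h' <;>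
    simp only [h, h'] <;> ring

end Expansions

/-! ### Levels of the expanded sums -/

section Membership

open FeatureLevel

variable {N m q k : ℕ}

theorem OffPair.dsum₂_pow_adj {F : (I : GraphInput.{u} N m) → I.V → I.V → ℤ}
    (hF : OffPair q k F) {p : ℕ} (hp : 1 ≤ p) (hq : p + 1 ≤ q) : OffPair q (k + 1) fun I i j =>
      dsum₂ {i, j} fun b c => F I i b * ((adj I ^ p) b c * adj I c j) := by
  simpa using hF.dsum₂_pow_pow hp le_rfl hq

theorem OffPair.dsum₂_adj_adj {F : (I : GraphInput.{u} N m) → I.V → I.V → ℤ}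
    (hF : OffPair q k F) (hq : 2 ≤ q) : OffPair q (k + 1) fun I i j =>
      dsum₂ {i, j} fun b c => F I i b * (adj I b c * adj I c j) := by
  simpa using hF.dsum₂_pow_adj le_rfl hq

/-- The number of common neighbors. -/
theorem offPair_cherry (hq : 1 ≤ q) : OffPair (N := N) (m := m) q (k + 1)
    fun (I : GraphInput.{u} N m) i j => dsum₁ {i, j} fun a => adj I i a * adj I a j :=
  (offPair_adj hq).dsum_adj hq

theorem offPair_pathSum_four (hq : 3 ≤ q) : OffPair (N := N) (m := m) q (k + 1)
    fun (I : GraphInput.{u} N m) i j => dsum₂ {i, j} fun a e =>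
      adj I i a * adj I e j * ((adj I ^ 2) a e - adj I i e - adj I a j) := by
  refine OffPair.congr (fun I i j hij => (isAdjMatrix_adj I).dsum₂_path_four hij) ?_
  have hA := offPair_adj (N := N) (m := m) (q := q) (k := k + 1) (by omega)
  have hQ := mixerNode_pow (N := N) (m := m) (q := q) (k := k) (p := 2) (by omega) (by omega)
  have hcherry := offPair_cherry (N := N) (m := m) (q := q) (k := k) (by omega)
  exact (((offPair_adj (by omega)).dsum₂_pow_adj (by omega) hq).sub
    ((((OffPair.left hQ).sub hA).sub (offPair_const 1)).mul hcherry)).sub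
    ((((OffPair.right hQ).sub hA).sub (offPair_const 1)).mul hcherry)

/-- The entrywise product of the adjacency matrix with one of its powers. -/
theorem fullPair_adj_mul_pow {p : ℕ} (hp : 1 ≤ p) (hq : p ≤ q) :
    FullPair (N := N) (m := m) q k
      fun (I : GraphInput.{u} N m) i j => adj I i j * (adj I ^ p) i j :=
  (fullPair_adj (by omega)).mul (fullPair_pow hp hq)

theorem offPair_adj_block_adj {p : ℕ} (hp : 1 ≤ p) (hq : p ≤ q) :
    OffPair (N := N) (m := m) q (k + 2) fun (I : GraphInput.{u} N m) i j =>
      dsum₂ {i, j} fun a e => adj I i a * (adj I a e * (adj I ^ p) a e * adj I e j) :=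
  (fullPair_adj_mul_pow hp hq).dsum₂_adj_adj
    (fun I a => by rw [(isAdjMatrix_adj I).apply_diag, zero_mul]) (by omega)

/-- Two layers go, for instance, into the block `A (A ∘ A²) A`, whose middle factor is an entrywise
product. -/
theorem offPair_pendantSum (hq : 3 ≤ q) : OffPair (N := N) (m := m) q (k + 2)
    fun (I : GraphInput.{u} N m) i j => pendantSum (adj I) i j := by
  refine OffPair.congr (fun I i j hij => (isAdjMatrix_adj I).pendantSum_eq hij) ?_
  have h1 : 1 ≤ q := by omega
  have h2 : 2 ≤ q := by omega
  have hA : ∀ k, OffPair (N := N) (m := m) q k fun (I : GraphInput.{u} N m) i j => adj I i j :=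
    fun _ => offPair_adj h1
  have hQ : ∀ k, OffPair (N := N) (m := m) q k
      fun (I : GraphInput.{u} N m) i j => (adj I ^ 2) i j :=
    fun _ => offPair_pow (by omega) h2
  have hd : ∀ k, MixerNode (N := N) (m := m) q k
      fun (I : GraphInput.{u} N m) i => (adj I ^ 2) i i := fun _ => mixerNode_pow (by omega) h2
  have hw : ∀ k, MixerNode (N := N) (m := m) q k
      fun (I : GraphInput.{u} N m) i => (adj I ^ 2) i i - 2 :=
    fun k => (hd k).sub (isNode_const 2)
  have hcherry := offPair_cherry (N := N) (m := m) (q := q) (k := k + 1) h1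
  have hc : OffPair (N := N) (m := m) q (k + 2)
      fun (I : GraphInput.{u} N m) i j => (adj I ^ 2) j j - adj I i j - 1 :=
    ((OffPair.right (hd _)).sub (hA _)).sub (offPair_const 1)
  have hAw := (hA (k + 1)).dsum_node_adj (hw _) h1
  refine .add (.add (.sub (.add (.add (.sub (.sub (.sub ?_ ?_) ?_) ?_) ?_) ?_) ?_) ?_) ?_
  · exact ((hA _).mul (OffPair.right (hw k))).dsum₂_pow_adj (by omega) hq
  · exact offPair_adj_block_adj (by omega) h2
  · exact (((((hA _).mul (offPair_pow (p := 3) (by omega) hq)).adj_dsum h1)).sub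
      ((hA _).dsum_node_adj (hd _) h1)).sub ((hA _).mul (((hA _).mul (hQ _)).dsum_adj h1))
  · exact (((OffPair.left ((fullPair_adj h1).sum_node (hw k))).sub
      ((hA _).mul (OffPair.right (hw _)))).mul hcherry).sub hAw
  · exact (((hA _).mul (hQ _)).dsum_adj h1).sub ((hA _).mul hcherry)
  · exact ((hQ _).sub (offPair_const 1)).mul hcherry
  · exact hc.mul hAw
  · exact (((hA _).mul (hQ _)).adj_dsum h1).sub ((hA _).mul hcherry)
  · exact hc.mul hcherry

theorem offPair_triangleSum (hq : 3 ≤ q) : OffPair (N := N) (m := m) q (k + 1)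
    fun (I : GraphInput.{u} N m) i j => triangleSum (adj I) i j := by
  refine OffPair.congr (fun I i j hij => (isAdjMatrix_adj I).triangleSum_eq hij) ?_
  have h1 : 1 ≤ q := by omega
  have h2 : 2 ≤ q := by omega
  have hA : ∀ k, OffPair (N := N) (m := m) q k fun (I : GraphInput.{u} N m) i j => adj I i j :=
    fun _ => offPair_adj h1
  have hQ : ∀ k, OffPair (N := N) (m := m) q k
      fun (I : GraphInput.{u} N m) i j => (adj I ^ 2) i j :=
    fun _ => offPair_pow (by omega) h2
  have hcherry := offPair_cherry (N := N) (m := m) (q := q) (k := k) h1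
  refine .add (.add (.sub (.mul (.sub ?_ ?_) ?_) (.mul (offPair_const 2) ?_))
    (.mul (offPair_const 2) (.add ?_ (.mul (hA _) ?_))))
    (.mul (.mul (offPair_const 2) (hA _)) (.sub ?_ (.mul (hA _) hcherry)))
  · exact OffPair.left (mixerNode_pow (by omega) hq)
  · exact (offPair_const 2).mul ((hA _).mul (hQ _))
  · exact (hA _).dsum₂_adj_adj h2
  · exact ((hA _).mul (hQ _)).dsum₂_adj_adj h2
  · exact ((hA _).mul (((offPair_const 1).sub (hQ _)).mul (hQ _))).dsum_adj h1
  · exact ((hA _).mul (((offPair_const 2).mul (hQ _)).sub (offPair_const 2))).dsum_adj h1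
  · exact ((hA _).mul (hQ _)).adj_dsum h1

section Middle

variable {p : ℕ}

/-- The sum over `b` and `c` of the paths `i, b, j` with a vertex `c` next to `b`. -/
theorem offPair_middle_fork (hp : 1 ≤ p) (hpq : p + 1 ≤ q) :
    OffPair (N := N) (m := m) q (k + 2) fun (I : GraphInput.{u} N m) i j => dsum₂ {i, j}
      fun b c => (adj I ^ 2) i b * adj I b j * (adj I b c * (adj I ^ p) b c) := by
  have hB := fullPair_adj_mul_pow (N := N) (m := m) (q := q) (k := k) hp (by omega)
  have hB' := fullPair_adj_mul_pow (N := N) (m := m) (q := q) (k := k + 1) hp (by omega)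
  have hQ := offPair_pow (N := N) (m := m) (q := q) (k := k + 1) (p := 2) (by omega) (by omega)
  refine OffPair.congr (fun I i j hij => ?_) (((hQ.dsum_node_adj hB.sum (by omega)).sub
    ((hQ.mul hB'.offPair).dsum_adj (by omega))).sub
      (hB'.offPair.pow_dsum (p := 2) (by omega) (by omega)))
  have hA := isAdjMatrix_adj I
  rw [dsum₂_eq_left hij (fun b => (adj I ^ 2) i b * adj I b j)
    fun b c => adj I b c * (adj I ^ p) b c, ← dsum₁_sub, ← dsum₁_sub]
  refine dsum₁_congr fun b _ => ?_
  rw [hA.apply_diag, hA.comm i b, hA.pow_comm p i b]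
  linear_combination (-(adj I ^ 2) i b * (adj I ^ p) b j) * hA.sq b j

/-- The sum over `b` and `c` of the closed walks at `i` through `b` and `c`. -/
theorem offPair_middle_closed (hp : 1 ≤ p) (hpq : p + 1 ≤ q) :
    OffPair (N := N) (m := m) q (k + 1) fun (I : GraphInput.{u} N m) i j => adj I i j *
      dsum₂ {i, j} fun b c => (adj I ^ 2) i b * ((adj I ^ p) b c * adj I c i) := by
  have hQ := offPair_pow (N := N) (m := m) (q := q) (k := k) (p := 2) (by omega) (by omega)
  have hA := offPair_adj (N := N) (m := m) (q := q) (k := k) (by omega)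
  have hA' := offPair_adj (N := N) (m := m) (q := q) (k := k + 1) (by omega)
  refine OffPair.congr (fun I i j hij => ?_) (hA'.mul
    ((((hQ.mul (offPair_pow (p := p + 1) (by omega) hpq)).dsum).sub
      ((hQ.mul hA).dsum_node (mixerNode_pow hp (by omega)))).sub
      (hA'.mul (hQ.dsum_pow hp (by omega)))))
  have hA := isAdjMatrix_adj I
  congr 1
  rw [dsum₂_eq_left hij _ fun b c => (adj I ^ p) b c * adj I c i, ← dsum₁_mul_left, ← dsum₁_sub,
    ← dsum₁_sub]
  refine dsum₁_congr fun b _ => ?_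
  have h : ∑ c, (adj I ^ p) b c * adj I c i = (adj I ^ (p + 1)) b i := by
    rw [pow_succ, Matrix.mul_apply]
  rw [h, hA.apply_diag, hA.comm i b, hA.comm i j, hA.pow_comm (p + 1) i b]
  ring

/-- The sum over the neighbors `c` of `i` and their neighbors `b`. -/
theorem offPair_middle_tree (hp : 1 ≤ p) (hpq : p + 1 ≤ q) :
    OffPair (N := N) (m := m) q (k + 2) fun (I : GraphInput.{u} N m) i j => adj I i j *
      dsum₂ {i, j} fun b c => adj I i c * (adj I b c * (adj I ^ p) b c) := by
  have hB := fullPair_adj_mul_pow (N := N) (m := m) (q := q) (k := k) hp (by omega)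
  have hB' := fullPair_adj_mul_pow (N := N) (m := m) (q := q) (k := k + 1) hp (by omega)
  have hA := offPair_adj (N := N) (m := m) (q := q) (k := k + 1) (by omega)
  have hA' := offPair_adj (N := N) (m := m) (q := q) (k := k + 2) (by omega)
  refine OffPair.congr (fun I i j hij => ?_) (hA'.mul (((hA.dsum_node hB.sum).sub
    hB'.offPair.dsum).sub (hB'.offPair.adj_dsum (by omega))))
  have hA := isAdjMatrix_adj I
  congr 1
  rw [dsum₂_eq_right hij _ fun b c => adj I b c * (adj I ^ p) b c, ← dsum₁_sub, ← dsum₁_sub]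
  refine dsum₁_congr fun c _ => ?_
  have h : ∑ b, adj I b c * (adj I ^ p) b c = ∑ b, adj I c b * (adj I ^ p) c b :=
    Finset.sum_congr rfl fun b _ => by rw [hA.comm c b, hA.pow_comm p c b]
  rw [h, hA.apply_diag, hA.comm c j, hA.pow_comm p c j]
  linear_combination (-(adj I ^ p) i c) * hA.sq i c

/-- With `K = Aᵖ` every term is a matrix product or an entrywise product with `A`. Reversing the
path matches the fork, closed and tree terms in pairs, so `swap` handles the second of each. -/
theorem offPair_middleSum (hp : 1 ≤ p) (hpq : p + 4 ≤ q) :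
    OffPair (N := N) (m := m) q (k + 2)
      fun (I : GraphInput.{u} N m) i j => middleSum (adj I) (adj I ^ p) i j := by
  refine OffPair.congr (fun I i j hij => ((isAdjMatrix_adj I).middleSum_eq (adj I ^ p)).trans
    (congrArg _ ((isAdjMatrix_adj I).sum_dsum₂_star hij p))) ?_
  have h1 : 1 ≤ q := by omega
  have hA : ∀ k, OffPair (N := N) (m := m) q k fun (I : GraphInput.{u} N m) i j => adj I i j :=
    fun _ => offPair_adj h1
  have hP : ∀ k, OffPair (N := N) (m := m) q k
      fun (I : GraphInput.{u} N m) i j => (adj I ^ (p + 1)) i j :=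
    fun _ => offPair_pow (by omega) (by omega)
  have hK : ∀ k, MixerNode (N := N) (m := m) q k
      fun (I : GraphInput.{u} N m) i => (adj I ^ p) i i := fun _ => mixerNode_pow hp (by omega)
  have hpair : ∀ {I : GraphInput.{u} N m} (i j : I.V), ({j, i} : Finset I.V) = {i, j} :=
    fun i j => Finset.pair_comm j i
  refine .sub (.add (.add (.sub (.add (.add (.sub (.sub (.sub ?_ ?_) ?_) ?_) ?_) ?_) ?_) ?_) ?_)
    (.add (.sub (.sub ?_ (.mul (offPair_const 2) ?_)) (.mul (offPair_const 2) ?_)) (.mul ?_ ?_))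
  · exact (offPair_pow (by omega) (by omega)).dsum₂_pow_pow hp (by omega) (by omega)
  · exact offPair_middle_fork hp (by omega)
  · exact offPair_middle_closed hp (by omega)
  · refine OffPair.congr (fun I i j hij => ?_) (offPair_middle_fork hp (by omega)).swap
    have hA := isAdjMatrix_adj I
    rw [dsum₂_swap, hpair]
    refine dsum₂_congr fun b c _ _ => ?_
    rw [hA.comm b c, hA.pow_comm p b c, hA.comm i b, hA.pow_comm 2 b j]
    ring
  · refine OffPair.congr (fun I i j hij => ?_) (offPair_adj_block_adj hp (by omega))
    have hA := isAdjMatrix_adj I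
    rw [dsum₂_swap]
    refine dsum₂_congr fun b c _ _ => ?_
    rw [hA.comm b c, hA.pow_comm p b c]
  · exact offPair_middle_tree hp (by omega)
  · refine OffPair.congr (fun I i j hij => ?_) (offPair_middle_closed hp (by omega)).swap
    have hA := isAdjMatrix_adj I
    rw [dsum₂_swap, hpair, hA.comm i j]
    congr 1
    refine dsum₂_congr fun b c _ _ => ?_
    rw [hA.pow_comm p b c, hA.pow_comm 2 b j]
  · refine OffPair.congr (fun I i j hij => ?_) (offPair_middle_tree hp (by omega)).swap
    have hA := isAdjMatrix_adj I
    rw [dsum₂_swap, hpair, hA.comm i j]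
    congr 1
    refine dsum₂_congr fun b c _ _ => ?_
    rw [hA.comm c j, hA.comm b c, hA.pow_comm p b c]
  · refine OffPair.congr (fun I i j hij => ?_) ((hA _).mul
      ((hA _).dsum₂_pow_adj hp (by omega)))
    have hA := isAdjMatrix_adj I
    rw [dsum₂_swap]
    congr 1
    refine dsum₂_congr fun b c _ _ => ?_
    rw [hA.pow_comm p b c]
  · exact (hA _).dsum_node_adj (((fullPair_adj_mul_pow (by omega) (by omega)).sum).sub
      ((fullPair_adj h1).sum_node (hK k))) h1
  · exact ((hA _).mul (hP _)).dsum_adj h1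
  · exact ((hA _).mul (hP _)).adj_dsum h1
  · exact (((offPair_const 2).mul (OffPair.left (hK _))).add
      ((offPair_const 2).mul (OffPair.right (hK _)))).add
        ((offPair_const 2).mul (offPair_pow hp (by omega)))
  · exact offPair_cherry h1

end Middle

theorem canCountPaths_of_offPair (ver : PSTVersion) (q k L : ℕ)
    (h : ∀ N m : ℕ, OffPair.{u} (N := N) (m := m) q k
      fun I i j => (pathCount I.G L i j : ℤ)) : CanCountPaths.{u} ver (k + 1) L := by
  refine canCountPaths_of_isPair ver q k L fun N m => ?_
  obtain ⟨F, hF, hF'⟩ := h N m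
  exact ⟨F, hF, fun I i j hij => (hF' I i j hij).symm⟩

end Membership

/-! ### Conclusion for the lengths 1 to 6 -/

theorem theorem6 (ver : PSTVersion) :
    (CanCountPaths.{u} ver 1 1 ∧ CanCountPaths.{u} ver 1 2) ∧
    (CanCountPaths.{u} ver 2 3 ∧ CanCountPaths.{u} ver 2 4) ∧
    (CanCountPaths.{u} ver 4 5 ∧ CanCountPaths.{u} ver 4 6) := by
  -- The bound `q = 6` on exponents meets `p + 4 ≤ q` in `offPair_middleSum` for `p = 2` and is kept
  -- for all lengths.
  refine ⟨⟨canCountPaths_of_offPair ver 6 0 1 fun N m => ?_,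
    canCountPaths_of_offPair ver 6 0 2 fun N m => ?_⟩,
    ⟨canCountPaths_of_offPair ver 6 1 3 fun N m => ?_,
      canCountPaths_of_offPair ver 6 1 4 fun N m => ?_⟩,
    ⟨canCountPaths_of_offPair ver 6 3 5 fun N m => ?_,
      canCountPaths_of_offPair ver 6 3 6 fun N m => ?_⟩⟩
  · exact .congr (fun I i j hij => pathCount_one I.G hij) (offPair_adj (by omega))
  · refine .congr (fun I i j hij => ?_) (offPair_pow (p := 2) (by omega) (by omega))
    rw [pathCount_eq_avoidCount I.G 2 hij,
      avoidCount_erase_two I.G (by simp) (by simp) hij]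
    have hA := isAdjMatrix_adj I
    have := dsum₁_pair hij fun a => adj I i a * adj I a j
    rw [hA.sum_mul', hA.apply_diag, hA.apply_diag] at this
    refine Eq.trans this ?_
    ring
  · refine .congr (fun I i j hij => ?_) ((offPair_adj (by omega)).dsum₂_adj_adj (by omega))
    rw [pathCount_eq_avoidCount I.G 3 hij,
      avoidCount_erase_three I.G (by simp) (by simp) hij]
    rfl
  · refine .congr (fun I i j hij => ?_) (offPair_pathSum_four (by omega))
    rw [pathCount_eq_avoidCount I.G 4 hij,
      avoidCount_erase_four I.G (by simp) (by simp) hij]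
    exact (isAdjMatrix_adj I).dsum₃_path hij
  -- Here `k = 1`. The lemma with `k = 0` would already give level `2`; level `3` matches the
  -- prescribed four layers.
  · refine .congr (fun I i j hij => ?_) (offPair_middleSum (p := 1) (by omega) (by omega))
    rw [pathCount_eq_avoidCount I.G 5 hij,
      avoidCount_erase_five I.G (by simp) (by simp) hij, pow_one]
    exact (isAdjMatrix_adj I).dsum₄_path hij
  · have h2 := offPair_triangleSum.{u} (N := N) (m := m) (q := 6) (k := 2) (by omega)
    have h3 := offPair_pendantSum.{u} (N := N) (m := m) (q := 6) (k := 1) (by omega)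
    refine .congr (fun I i j hij => ?_) (((((offPair_middleSum (p := 2) (by omega)
      (by omega)).sub h2).sub h2.swap).sub h3).sub h3.swap)
    rw [pathCount_eq_avoidCount I.G 6 hij,
      avoidCount_erase_six I.G (by simp) (by simp) hij]
    exact (isAdjMatrix_adj I).dsum₅_path hij
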